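/- Let $\mathcal V$ be a symmetric monoidal closed category whose underlying ordinary category is locally small, complete and cocomplete. Here "category" and "functor" mean $\mathcal V$-category and $\mathcal V$-functor, and $[\mathcal K,\mathcal A]$ (for $\mathcal K$ small) is the $\mathcal V$-category of $\mathcal V$-functors $\mathcal K\to\mathcal A$. A *weight* is a functor $\phi:\mathcal K\to\mathcal V$ with $\mathcal K$ small. For $T:\mathcal K\to\mathcal A$, a limit $\{\phi,T\}$ is an object of $\mathcal A$ with a $\mathcal V$-natural transformation $\phi\to\mathcal A(\{\phi,T\},T-)$ for which the induced morphism $\mathcal A(a,\{\phi,T\})\to[\mathcal K,\mathcal V](\phi,\mathcal A(a,T-))$ is invertible for every $a\in\mathcal A$. For $S:\mathcal K^{op}\to\mathcal A$, the colimit $\phi*S$ is the limit $\{\phi,S^{op}\}$ in $\mathcal A^{op}$. A functor $F:\mathcal A\to\mathcal B$ preserves a limit $\{\phi,T\}$ when the composite $\phi\to\mathcal A(\{\phi,T\},T-)\to\mathcal B(F\{\phi,T\},FT-)$ exhibits $F\{\phi,T\}$ as $\{\phi,FT\}$. For a class $\Phi$ of weights, a category is *$\Phi$-complete* when it admits all limits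 $\{\phi,T\}$ with $\phi\in\Phi$, and a functor between $\Phi$-complete categories is *$\Phi$-continuous* when it preserves all of these; for a single weight $\psi$ one says $\psi$-complete and $\psi$-continuous. The *saturation* $\Phi^{*}$ is the class of all weights $\psi$ such that every $\Phi$-complete category is $\psi$-complete and every $\Phi$-continuous functor between $\Phi$-complete categories is $\psi$-continuous. For weights $\phi:\mathcal L^{op}\to\mathcal V$ and $\psi$, one says that *$\phi$-colimits commute with $\psi$-limits in $\mathcal V$* when the functor $\phi*-:[\mathcal L,\mathcal V]\to\mathcal V$ preserves all $\psi$-limits. For classes $\Phi,\Psi$ of weights, let $\Psi^{+}$ be the class of the weights $\phi$ such that $\phi$-colimits commute with $\psi$-limits in $\mathcal V$ for all $\psi\in\Psi$ (the $\Psi$-flat weights), and let $\Phi^{-}$ be the class of the weights $\psi$ such that $\phi$-colimits commute with $\psi$-limits in $\mathcal V$ for all $\phi\in\Phi$. **Proposition.** For any classes $\Phi$ and $\Psi$ of weights, the classes $\Psi^{+}$ and $\Phi^{-}$ are saturated, that is, $$(\Psi^{+})^{*}=\Psi^{+},\qquad (\Phi^{-})^{*}=\Phi^{-}.$$ Moreover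 $$\Psi^{+}=(\Psi^{*})^{+},\qquad \Phi^{-}=(\Phi^{*})^{-}.$$ -/

import Mathlib

open CategoryTheory MonoidalCategory BraidedCategory MonoidalClosed Limits Opposite
universe w v u u₁ u₂
set_option linter.unusedSectionVars false
noncomputable section
namespace EnrichedWeights

section Composition
variable {V : Type u} [Category.{w} V] [MonoidalCategory V]
variable {C : Type u₁} [EnrichedCategory V C]

lemma tensor_eComp_assoc {a b c d : C} {X Y Z : V}
    (f : X ⟶ EnrichedCategory.Hom a b) (g : Y ⟶ EnrichedCategory.Hom b c)
    (h : Z ⟶ EnrichedCategory.Hom c d) :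
    (((f ⊗ₘ g) ≫ eComp V a b c) ⊗ₘ h) ≫ eComp V a c d =
      (α_ X Y Z).hom ≫ (f ⊗ₘ ((g ⊗ₘ h) ≫ eComp V b c d)) ≫ eComp V a b d := by
  have h1 : ((f ⊗ₘ g) ≫ eComp V a b c) ⊗ₘ h = ((f ⊗ₘ g) ⊗ₘ h) ≫ (eComp V a b c ▷ _) := by
    rw [← tensorHom_id, tensorHom_comp_tensorHom, Category.comp_id]
  have h2 : (f ⊗ₘ ((g ⊗ₘ h) ≫ eComp V b c d)) = (f ⊗ₘ (g ⊗ₘ h)) ≫ (_ ◁ eComp V b c d) := by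
    rw [← id_tensorHom, tensorHom_comp_tensorHom, Category.comp_id]
  rw [h1, h2, Category.assoc, Category.assoc, ← e_assoc', associator_naturality_assoc]

lemma tensor_eId_eComp {a b : C} {X : V}
    (f : X ⟶ EnrichedCategory.Hom a b) :
    (f ⊗ₘ eId V b) ≫ eComp V a b b = (ρ_ X).hom ≫ f := by
  rw [MonoidalCategory.tensorHom_def, Category.assoc, ← cancel_epi (ρ_ X).inv,
    ← rightUnitor_inv_naturality_assoc, e_comp_id, Iso.inv_hom_id_assoc, Category.comp_id]

lemma eId_tensor_eComp {a b : C} {X : V}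
    (f : X ⟶ EnrichedCategory.Hom a b) :
    (eId V a ⊗ₘ f) ≫ eComp V a a b = (λ_ X).hom ≫ f := by
  rw [tensorHom_def', Category.assoc, ← cancel_epi (λ_ X).inv,
    ← leftUnitor_inv_naturality_assoc, e_id_comp, Iso.inv_hom_id_assoc, Category.comp_id]

end Composition

section Self
variable {V : Type u} [Category.{w} V] [MonoidalCategory V] [MonoidalClosed V]

lemma uncurry_eComp {A B C X Y : V} (f : X ⟶ (ihom A).obj B) (g : Y ⟶ (ihom B).obj C) :
    uncurry ((f ⊗ₘ g) ≫ eComp V A B C) = (α_ A X Y).inv ≫ uncurry f ▷ Y ≫ uncurry g := by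
  change uncurry ((f ⊗ₘ g) ≫ MonoidalClosed.comp A B C) = _
  rw [uncurry_natural_left, MonoidalClosed.comp_eq, uncurry_curry, compTranspose_eq,
    uncurry_eq, uncurry_eq, MonoidalCategory.tensorHom_def]
  simp only [MonoidalCategory.whiskerLeft_comp, comp_whiskerRight, Category.assoc,
    associator_inv_naturality_right_assoc, associator_inv_naturality_middle_assoc,
    whisker_exchange_assoc]
  rfl

variable {K : Type u₁} [EnrichedCategory V K] {A : Type u₂} [EnrichedCategory V A]

/-- The `V`-functor `A(a, T-) : K ⟶ V`, where `V` is enriched in itself by its internal hom. Its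
value on hom-objects is the transpose of `A(a, T k) ⊗ K(k, l) ⟶ A(a, T l)`, see
`uncurry_homFrom_map`. (Composition in an enriched category is written in diagrammatic order.) -/
@[reducible]
def homFrom (a : A) (T : EnrichedFunctor V K A) : EnrichedFunctor V K V where
  obj k := (EnrichedCategory.Hom a (T.obj k) : V)
  map k l := T.map k l ≫ curry (eComp V a (T.obj k) (T.obj l))
  map_id k := by
    apply uncurry_injective
    rw [T.map_id_assoc, ← curry_natural_left, uncurry_curry]
    change _ = uncurry (curry (ρ_ _).hom)
    rw [uncurry_curry, ← cancel_epi (ρ_ _).inv, e_comp_id, Iso.inv_hom_id]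
  map_comp k l m := by
    rw [T.map_comp_assoc, ← tensorHom_comp_tensorHom, Category.assoc]
    congr 1
    apply uncurry_injective
    rw [← curry_natural_left, uncurry_curry, uncurry_eComp, uncurry_curry, uncurry_curry, e_assoc]

lemma uncurry_homFrom_map (T : EnrichedFunctor V K A) (a : A) (k l : K) :
    uncurry ((homFrom a T).map k l) =
      (EnrichedCategory.Hom a (T.obj k) : V) ◁ T.map k l ≫ eComp V a (T.obj k) (T.obj l) := by
  rw [uncurry_natural_left, uncurry_curry]

end Self

section FunctorCategory
variable {V : Type u} [Category.{w} V] [MonoidalCategory V] [SymmetricCategory V] [MonoidalClosed V]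
variable {K : Type w} [EnrichedCategory V K] {D : Type u₂} [EnrichedCategory V D]
variable (F G H : EnrichedFunctor V K D)

/-- `V`-naturality in `k` of a family `s k : X ⟶ D(F k, G k)`: the two ways of composing
`K(k, l) ⊗ X ⟶ D(F k, G l)`, namely `F` followed by `s l` and `s k` followed by `G`, agree.
For `X` the unit object this is Kelly's definition of a `V`-natural transformation `F ⟶ G`. -/
def IsNatural {X : V} (s : ∀ k : K, X ⟶ (EnrichedCategory.Hom (F.obj k) (G.obj k) : V)) : Prop :=
  ∀ k l : K, (F.map k l ⊗ₘ s l) ≫ eComp V (F.obj k) (F.obj l) (G.obj l) =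
    (β_ (EnrichedCategory.Hom k l) X).hom ≫ (s k ⊗ₘ G.map k l) ≫
      eComp V (F.obj k) (G.obj k) (G.obj l)

lemma isNatural_of_uncurry {F G : EnrichedFunctor V K V} {X : V}
    (s : ∀ k : K, F.obj k ⊗ X ⟶ G.obj k)
    (h : ∀ k l : K, (α_ _ _ _).inv ≫ uncurry (F.map k l) ▷ X ≫ s l =
      F.obj k ◁ (β_ _ _).hom ≫ (α_ _ _ _).inv ≫ s k ▷ _ ≫ uncurry (G.map k l)) :
    IsNatural F G (fun k => (curry (s k) : X ⟶ (ihom (F.obj k)).obj (G.obj k))) := by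
  intro k l
  dsimp only
  apply uncurry_injective
  have e1 := uncurry_eComp (F.map k l) (curry (s l))
  have e2 := uncurry_eComp (curry (s k)) (G.map k l)
  rw [uncurry_curry] at e1 e2
  refine e1.trans ((h k l).trans ?_)
  rw [← e2]
  exact (uncurry_natural_left _ _).symm

variable [HasLimits V]

/-- The product of the objects `D(F k, G k)`. -/
abbrev natProd : V := ∏ᶜ fun k : K => (EnrichedCategory.Hom (F.obj k) (G.obj k) : V)

/-- The product of the objects `[K(k, l), D(F k, G l)]`. -/
abbrev natProd₂ : V := ∏ᶜ fun p : K × K => (ihom (EnrichedCategory.Hom p.1 p.2 : V)).obj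
    (EnrichedCategory.Hom (F.obj p.1) (G.obj p.2) : V)

/-- The transpose of `first F, then the family`. -/
def natLeft : natProd F G ⟶ natProd₂ F G :=
  Pi.lift fun p => curry ((F.map p.1 p.2 ⊗ₘ Pi.π _ p.2) ≫ eComp V _ _ _)

/-- The transpose of `first the family, then G`. -/
def natRight : natProd F G ⟶ natProd₂ F G :=
  Pi.lift fun p => curry ((β_ _ _).hom ≫ (Pi.π _ p.1 ⊗ₘ G.map p.1 p.2) ≫ eComp V _ _ _)

/-- The hom-object `[K, D](F, G)` of the enriched functor category: the end of `D(F k, G k)` over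
`k`, constructed as an equalizer of products. Its generalized elements `X ⟶ [K, D](F, G)` are the
`V`-natural families `X ⟶ D(F k, G k)`, see `natLift`, `natLift_eval`, `natEval_natural` and
`nat_hom_ext`. -/
def natObj : V := equalizer (natLeft F G) (natRight F G)

/-- The inclusion of the end into the product. -/
def natIncl : natObj F G ⟶ natProd F G := equalizer.ι (natLeft F G) (natRight F G)

/-- The component at `k`, as a morphism `[K, D](F, G) ⟶ D(F k, G k)`. -/
def natEval (k : K) : natObj F G ⟶ (EnrichedCategory.Hom (F.obj k) (G.obj k) : V) :=
  natIncl F G ≫ Pi.π _ k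

variable {F G H}

lemma natural_iff {X : V} (t : X ⟶ natProd F G) :
    IsNatural F G (fun k => t ≫ Pi.π _ k) ↔ t ≫ natLeft F G = t ≫ natRight F G := by
  have key (k l : K) : ((F.map k l ⊗ₘ (t ≫ Pi.π _ l)) ≫ eComp V (F.obj k) (F.obj l) (G.obj l) =
    (β_ (EnrichedCategory.Hom k l) X).hom ≫ ((t ≫ Pi.π _ k) ⊗ₘ G.map k l) ≫
      eComp V (F.obj k) (G.obj k) (G.obj l)) ↔
      (t ≫ natLeft F G) ≫ Pi.π _ (k, l) = (t ≫ natRight F G) ≫ Pi.π _ (k, l) := by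
    simp only [natLeft, natRight, Category.assoc, Pi.lift_π, ← curry_natural_left,
      curry_injective.eq_iff]
    simp [tensorHom_def', whisker_exchange_assoc]
  constructor
  · intro h
    exact Pi.hom_ext _ _ fun p => (key p.1 p.2).1 (h p.1 p.2)
  · intro h k l
    exact (key k l).2 (by rw [h])

/-- The universal property of the end `[K, D](F, G)`. -/
def natLift {X : V} (s : ∀ k : K, X ⟶ (EnrichedCategory.Hom (F.obj k) (G.obj k) : V))
    (hs : IsNatural F G s) : X ⟶ natObj F G :=
  equalizer.lift (Pi.lift s) ((natural_iff _).1 (by simpa only [Pi.lift_π] using hs))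

lemma natLift_eval {X : V} (s : ∀ k : K, X ⟶ (EnrichedCategory.Hom (F.obj k) (G.obj k) : V))
    (hs : IsNatural F G s) (k : K) : natLift s hs ≫ natEval F G k = s k := by
  have h : natLift s hs ≫ natIncl F G = Pi.lift s := equalizer.lift_ι _ _
  rw [natEval, ← Category.assoc, h, Pi.lift_π]

lemma nat_hom_ext {X : V} {f g : X ⟶ natObj F G}
    (h : ∀ k, f ≫ natEval F G k = g ≫ natEval F G k) : f = g := by
  have h' : f ≫ natIncl F G = g ≫ natIncl F G :=
    Pi.hom_ext _ _ fun k => by simpa only [natEval, Category.assoc] using h k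
  exact equalizer.hom_ext h'

lemma natEval_natural {X : V} (t : X ⟶ natObj F G) :
    IsNatural F G (fun k => t ≫ natEval F G k) := by
  have h : natIncl F G ≫ natLeft F G = natIncl F G ≫ natRight F G := equalizer.condition _ _
  have := (natural_iff (t ≫ natIncl F G)).2 (by rw [Category.assoc, Category.assoc, h])
  simpa only [natEval, Category.assoc] using this

lemma isNatural_eval : IsNatural F G (natEval F G) := by
  simpa using natEval_natural (𝟙 (natObj F G))

lemma isNatural_id : IsNatural F F (fun k => eId V (F.obj k)) := by
  intro k l
  dsimp only
  rw [tensor_eId_eComp, eId_tensor_eComp, braiding_tensorUnit_right, Category.assoc,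
    Iso.inv_hom_id_assoc]

lemma isNatural_comp {X Y : V} {s : ∀ k : K, X ⟶ (EnrichedCategory.Hom (F.obj k) (G.obj k) : V)}
    {t : ∀ k : K, Y ⟶ (EnrichedCategory.Hom (G.obj k) (H.obj k) : V)}
    (hs : IsNatural F G s) (ht : IsNatural G H t) :
    IsNatural F H (fun k => (s k ⊗ₘ t k) ≫ eComp V (F.obj k) (G.obj k) (H.obj k)) := by
  intro k l
  dsimp only
  have e1 := tensor_eComp_assoc (F.map k l) (s l) (t l)
  have e2 := tensor_eComp_assoc (s k) (G.map k l) (t l)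
  have e3 := tensor_eComp_assoc (s k) (t k) (H.map k l)
  rw [hs k l, ← whiskerRight_comp_tensorHom_assoc, e2, ht k l, ← whiskerLeft_comp_tensorHom_assoc,
    ← Iso.inv_comp_eq] at e1
  rw [e3, ← e1, braiding_tensor_right_hom]
  simp only [Category.assoc, Iso.inv_hom_id_assoc]

variable (F G H) in
/-- The identity of `F` in the functor category. -/
def natId : 𝟙_ V ⟶ natObj F F := natLift _ isNatural_id

variable (F G H) in
/-- Composition in the functor category, given componentwise. -/
def natComp : natObj F G ⊗ natObj G H ⟶ natObj F H :=
  natLift (fun k => (natEval F G k ⊗ₘ natEval G H k) ≫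
    eComp V (F.obj k) (G.obj k) (H.obj k)) (isNatural_comp isNatural_eval isNatural_eval)

lemma natId_eval (F : EnrichedFunctor V K D) (k : K) :
    natId F ≫ natEval F F k = eId V (F.obj k) := natLift_eval _ isNatural_id k

lemma natComp_eval (F G H : EnrichedFunctor V K D) (k : K) :
    natComp F G H ≫ natEval F H k =
      (natEval F G k ⊗ₘ natEval G H k) ≫ eComp V (F.obj k) (G.obj k) (H.obj k) :=
  natLift_eval _ (isNatural_comp isNatural_eval isNatural_eval) k

/-- The enriched functor category `[K, D]` for small `K`: the objects are the `V`-functors, the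
hom-objects are the ends `natObj F G`, identities and composition are componentwise. -/
instance functorCategory : EnrichedCategory V (EnrichedFunctor V K D) where
  Hom F G := natObj F G
  id F := natId F
  comp F G H := natComp F G H
  id_comp F G := nat_hom_ext fun k => by
    simp only [Category.assoc, natComp_eval, Category.id_comp]
    rw [whiskerRight_comp_tensorHom_assoc, natId_eval, eId_tensor_eComp, Iso.inv_hom_id_assoc]
  comp_id F G := nat_hom_ext fun k => by
    simp only [Category.assoc, natComp_eval, Category.id_comp]
    rw [whiskerLeft_comp_tensorHom_assoc, natId_eval, tensor_eId_eComp, Iso.inv_hom_id_assoc]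
  assoc F G H J := nat_hom_ext fun k => by
    simp only [Category.assoc, natComp_eval]
    rw [whiskerLeft_comp_tensorHom_assoc, whiskerRight_comp_tensorHom_assoc, natComp_eval,
      natComp_eval, tensor_eComp_assoc, Iso.inv_hom_id_assoc]

end FunctorCategory

section Limits
variable {V : Type u} [Category.{w} V] [MonoidalCategory V] [SymmetricCategory V] [MonoidalClosed V]
  [HasLimits V]
variable {K : Type w} [EnrichedCategory V K] {A : Type u₁} [EnrichedCategory V A]
  {B : Type u₂} [EnrichedCategory V B]

/-- A cone over `T : K ⟶ A` with weight `φ : K ⟶ V`: an object `pt` and a `V`-natural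
transformation `π : φ ⟶ A(pt, T-)`. The equation is `V`-naturality, with both sides transposed to
morphisms `φ k ⊗ K(k, l) ⟶ A(pt, T l)`. -/
structure WeightedCone (φ : EnrichedFunctor V K V) (T : EnrichedFunctor V K A) where
  /-- the vertex -/
  pt : A
  /-- the components of the counit -/
  π (k : K) : φ.obj k ⟶ (EnrichedCategory.Hom pt (T.obj k) : V)
  naturality (k l : K) :
    uncurry (φ.map k l) ≫ π l = (π k ⊗ₘ T.map k l) ≫ eComp V pt (T.obj k) (T.obj l)

namespace WeightedCone
variable {φ : EnrichedFunctor V K V} {T : EnrichedFunctor V K A} (c : WeightedCone φ T)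

lemma isNatural_comparison (a : A) :
    IsNatural φ (homFrom a T) (fun k => curry ((β_ (φ.obj k) (EnrichedCategory.Hom a c.pt)).hom ≫
        (EnrichedCategory.Hom a c.pt : V) ◁ c.π k ≫ eComp V a c.pt (T.obj k))) := by
  refine isNatural_of_uncurry _ fun k l => ?_
  rw [uncurry_homFrom_map, ← braiding_naturality_left_assoc, ← comp_whiskerRight_assoc,
    c.naturality, braiding_naturality_left_assoc, ← id_tensorHom]
  have h := tensor_eComp_assoc (𝟙 (EnrichedCategory.Hom a c.pt : V)) (c.π k) (T.map k l)
  rw [← Iso.inv_comp_eq] at h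
  rw [← h, braiding_tensor_left_hom, id_tensorHom]
  simp only [Category.assoc, Iso.inv_hom_id_assoc, Iso.hom_inv_id_assoc, comp_whiskerRight,
    MonoidalCategory.tensorHom_def]

/-- The comparison `A(a, pt) ⟶ [K, V](φ, A(a, T-))` induced by a cone `π : φ ⟶ A(pt, T-)`; its
component at `k` is the transpose of the composite
`φ k ⊗ A(a, pt) ≅ A(a, pt) ⊗ φ k ⟶ A(a, pt) ⊗ A(pt, T k) ⟶ A(a, T k)`. -/
def comparison (a : A) :
    (EnrichedCategory.Hom a c.pt : V) ⟶ natObj φ (homFrom a T) :=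
  natLift _ (c.isNatural_comparison a)

/-- The cone exhibits `pt` as the limit `{φ, T}` of `T` weighted by `φ`: the `V`-natural
comparison `A(a, pt) ⟶ [K, V](φ, A(a, T-))` is invertible for every `a`. -/
def IsLimit : Prop := ∀ a : A, IsIso (c.comparison a)

lemma comp_comparison_eval {a : A} {X : V} (f : X ⟶ EnrichedCategory.Hom a c.pt) (k : K) :
    (f ≫ c.comparison a) ≫ natEval φ (homFrom a T) k =
      curry ((β_ (φ.obj k) X).hom ≫ (f ⊗ₘ c.π k) ≫ eComp V a c.pt (T.obj k)) := by
  rw [comparison, Category.assoc, natLift_eval, MonoidalCategory.tensorHom_def]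
  refine (curry_natural_left _ _).symm.trans ?_
  rw [Category.assoc, ← braiding_naturality_right_assoc]

variable {c}

lemma IsLimit.hom_ext (hc : c.IsLimit) {a : A} {X : V} {f g : X ⟶ EnrichedCategory.Hom a c.pt}
    (h : ∀ k, (f ⊗ₘ c.π k) ≫ eComp V a c.pt (T.obj k) =
      (g ⊗ₘ c.π k) ≫ eComp V a c.pt (T.obj k)) : f = g := by
  have := hc a
  rw [← cancel_mono (c.comparison a)]
  refine nat_hom_ext fun k => ?_
  rw [comp_comparison_eval, comp_comparison_eval, h]

/-- A `V`-natural family `φ k ⊗ X ⟶ A(a, T k)`, that is, a generalized element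
`X ⟶ [K, V](φ, A(a, T-))` in transposed form. -/
def IsConeFamily (φ : EnrichedFunctor V K V) (T : EnrichedFunctor V K A) (a : A) (X : V)
    (s : ∀ k : K, φ.obj k ⊗ X ⟶ (EnrichedCategory.Hom a (T.obj k) : V)) : Prop :=
  ∀ k l : K, (α_ _ _ _).inv ≫ uncurry (φ.map k l) ▷ X ≫ s l =
      φ.obj k ◁ (β_ _ _).hom ≫ (α_ _ _ _).inv ≫ (s k ⊗ₘ T.map k l) ≫
        eComp V a (T.obj k) (T.obj l)

lemma IsConeFamily.isNatural {a : A} {X : V}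
    {s : ∀ k : K, φ.obj k ⊗ X ⟶ (EnrichedCategory.Hom a (T.obj k) : V)}
    (hs : IsConeFamily φ T a X s) :
    IsNatural φ (homFrom a T) (fun k => curry (s k)) := by
  refine isNatural_of_uncurry (G := homFrom a T) s fun k l => ?_
  rw [uncurry_homFrom_map, hs k l, MonoidalCategory.tensorHom_def, Category.assoc]

lemma IsLimit.exists_lift (hc : c.IsLimit) {a : A} {X : V}
    (s : ∀ k : K, φ.obj k ⊗ X ⟶ (EnrichedCategory.Hom a (T.obj k) : V))
    (hs : IsConeFamily φ T a X s) : ∃ f : X ⟶ EnrichedCategory.Hom a c.pt, ∀ k,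
      (f ⊗ₘ c.π k) ≫ eComp V a c.pt (T.obj k) = (β_ X (φ.obj k)).hom ≫ s k := by
  have := hc a
  refine ⟨natLift _ hs.isNatural ≫ inv (c.comparison a), fun k => ?_⟩
  have h := c.comp_comparison_eval (natLift _ hs.isNatural ≫ inv (c.comparison a)) k
  simp only [Category.assoc, IsIso.inv_hom_id_assoc, natLift_eval] at h
  rw [curry_injective h, SymmetricCategory.symmetry_assoc]

/-- The universal property of a weighted limit, for generalized elements. -/
def IsLimit.lift (hc : c.IsLimit) {a : A} {X : V}
    (s : ∀ k : K, φ.obj k ⊗ X ⟶ (EnrichedCategory.Hom a (T.obj k) : V))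
    (hs : IsConeFamily φ T a X s) : X ⟶ EnrichedCategory.Hom a c.pt :=
  (hc.exists_lift s hs).choose

lemma IsLimit.fac (hc : c.IsLimit) {a : A} {X : V}
    (s : ∀ k : K, φ.obj k ⊗ X ⟶ (EnrichedCategory.Hom a (T.obj k) : V))
    (hs : IsConeFamily φ T a X s) (k : K) :
    (hc.lift s hs ⊗ₘ c.π k) ≫ eComp V a c.pt (T.obj k) = (β_ X (φ.obj k)).hom ≫ s k :=
  (hc.exists_lift s hs).choose_spec k

lemma isLimit_of
    (ex : ∀ (a : A) (X : V) (s : ∀ k : K, φ.obj k ⊗ X ⟶ (EnrichedCategory.Hom a (T.obj k) : V)),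
      IsConeFamily φ T a X s → ∃ f : X ⟶ EnrichedCategory.Hom a c.pt, ∀ k,
      (f ⊗ₘ c.π k) ≫ eComp V a c.pt (T.obj k) = (β_ X (φ.obj k)).hom ≫ s k)
    (uniq : ∀ (a : A) (X : V) (f g : X ⟶ EnrichedCategory.Hom a c.pt),
      (∀ k, (f ⊗ₘ c.π k) ≫ eComp V a c.pt (T.obj k) =
        (g ⊗ₘ c.π k) ≫ eComp V a c.pt (T.obj k)) → f = g) : c.IsLimit := by
  intro a
  have hn : IsNatural φ (homFrom a T) (natEval φ (homFrom a T)) := isNatural_eval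
  obtain ⟨f, hf⟩ := ex a (natObj φ (homFrom a T))
    (fun k => uncurry (natEval φ (homFrom a T) k)) (by
      intro k l
      have e1 := uncurry_eComp (φ.map k l) (natEval φ (homFrom a T) l)
      have e2 := uncurry_eComp (natEval φ (homFrom a T) k) ((homFrom a T).map k l)
      have e3 := congrArg uncurry (hn k l)
      refine e1.symm.trans (e3.trans ((uncurry_natural_left _ _).trans ?_))
      refine (congrArg (fun z => _ ◁ _ ≫ z) e2).trans ?_
      rw [uncurry_homFrom_map, MonoidalCategory.tensorHom_def, Category.assoc])
  have h1 : f ≫ c.comparison a = 𝟙 (natObj φ (homFrom a T)) := nat_hom_ext fun k => by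
    rw [comp_comparison_eval, hf, SymmetricCategory.symmetry_assoc, curry_uncurry,
      Category.id_comp]
  refine ⟨f, uniq a _ _ _ fun k => ?_, h1⟩
  have h2 := c.comp_comparison_eval (c.comparison a ≫ f) k
  have h3 := c.comp_comparison_eval (𝟙 (EnrichedCategory.Hom a c.pt : V)) k
  have e : (c.comparison a ≫ f) ≫ c.comparison a = 𝟙 _ ≫ c.comparison a := by
    rw [Category.assoc, h1, Category.comp_id, Category.id_comp]
  rw [e, h3] at h2
  have h4 := curry_injective h2
  rw [cancel_epi] at h4
  exact h4.symm

/-- The image of a cone under a `V`-functor `F : A ⟶ B`: the composite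
`φ ⟶ A(pt, T-) ⟶ B(F pt, F T-)`. -/
def map (F : EnrichedFunctor V A B) (c : WeightedCone φ T) : WeightedCone φ (T.comp V F) where
  pt := F.obj c.pt
  π k := c.π k ≫ F.map c.pt (T.obj k)
  naturality k l := by
    have h := c.naturality k l =≫ F.map c.pt (T.obj l)
    rw [Category.assoc, Category.assoc, F.map_comp, tensorHom_comp_tensorHom_assoc] at h
    exact h

end WeightedCone

namespace WeightedCone
variable {φ : EnrichedFunctor V K V} {R S T : EnrichedFunctor V K A}
  (b : WeightedCone φ R) {c : WeightedCone φ S} {d : WeightedCone φ T}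

lemma isConeFamily_natEval (c : WeightedCone φ S) : IsConeFamily φ T c.pt (natObj S T)
    (fun k => (c.π k ⊗ₘ natEval S T k) ≫ eComp V c.pt (S.obj k) (T.obj k)) := by
  intro k l
  have hn : IsNatural S T (natEval S T) := isNatural_eval
  dsimp only
  rw [whiskerRight_comp_tensorHom_assoc, c.naturality, tensor_eComp_assoc, tensor_eComp_assoc,
    hn k l, Iso.inv_hom_id_assoc, Iso.inv_hom_id_assoc, whiskerLeft_comp_tensorHom_assoc]

/-- The morphism `[K, A](S, T) ⟶ A({φ, S}, {φ, T})` given by functoriality of limits. -/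
def IsLimit.map (c : WeightedCone φ S) (hd : d.IsLimit) :
    natObj S T ⟶ EnrichedCategory.Hom c.pt d.pt :=
  hd.lift _ c.isConeFamily_natEval

lemma IsLimit.map_fac (c : WeightedCone φ S) (hd : d.IsLimit) (k : K) :
    (hd.map c ⊗ₘ d.π k) ≫ eComp V _ _ _ = (β_ _ _).hom ≫
      (c.π k ⊗ₘ natEval S T k) ≫ eComp V _ _ _ :=
  hd.fac _ _ k

lemma IsLimit.map_id (hd : d.IsLimit) : natId T ≫ hd.map d = eId V d.pt :=
  hd.hom_ext fun k => by
    rw [← whiskerRight_comp_tensorHom_assoc, hd.map_fac, eId_tensor_eComp,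
      braiding_naturality_left_assoc, whiskerLeft_comp_tensorHom_assoc, natId_eval,
      tensor_eId_eComp, braiding_tensorUnit_left, Category.assoc, Iso.inv_hom_id_assoc]

lemma IsLimit.map_comp (hc : c.IsLimit) (hd : d.IsLimit) :
    natComp R S T ≫ hd.map b = (hc.map b ⊗ₘ hd.map c) ≫ eComp V _ _ _ :=
  hd.hom_ext fun k => by
    have e1 := tensor_eComp_assoc (hc.map b) (c.π k) (natEval S T k)
    have e2 := tensor_eComp_assoc (b.π k) (natEval R S k) (natEval S T k)
    rw [← Iso.inv_comp_eq] at e1 e2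
    rw [← whiskerRight_comp_tensorHom_assoc, hd.map_fac,
      braiding_naturality_left_assoc, whiskerLeft_comp_tensorHom_assoc, natComp_eval,
      tensor_eComp_assoc, hd.map_fac, ← whiskerLeft_comp_tensorHom_assoc (hc.map b), ← e1,
      hc.map_fac, ← whiskerRight_comp_tensorHom_assoc (β_ (natObj R S) (φ.obj k)).hom, ← e2,
      braiding_tensor_left_hom]
    simp only [Category.assoc, Iso.hom_inv_id_assoc]

end WeightedCone

/-- The `V`-functor `S^op : K ⟶ A^op` corresponding to `S : K^op ⟶ A`. A colimit `φ * S` is the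
same thing as a limit of `opDiagram S` weighted by `φ`. -/
def opDiagram (S : EnrichedFunctor V Kᵒᵖ A) : EnrichedFunctor V K Aᵒᵖ where
  obj k := op (S.obj (op k))
  map k l := S.map (op l) (op k)
  map_id k := S.map_id (op k)
  map_comp k l m := by
    have h := S.map_comp (op m) (op l) (op k)
    rw [eComp_op_eq, Category.assoc] at h
    refine Eq.trans ?_ (braiding_naturality_assoc (S.map (op l) (op k)) (S.map (op m) (op l))
      (eComp V (S.obj (op m)) (S.obj (op l)) (S.obj (op k)))).symm
    rw [← h]
    exact (SymmetricCategory.symmetry_assoc _ _ _).symm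

lemma isNatural_op (S T : EnrichedFunctor V Kᵒᵖ A) :
    IsNatural (opDiagram T) (opDiagram S) (fun k => natEval S T (op k)) := by
  intro k l
  have h : IsNatural S T (natEval S T) := isNatural_eval
  have h1 := h (op l) (op k)
  have e1 := tensorHom_eComp_op_eq (V := V) (z := op (T.obj (op k))) (y := op (T.obj (op l)))
    (x := op (S.obj (op l))) (T.map (op l) (op k)) (natEval S T (op l))
  have e2 := tensorHom_eComp_op_eq (V := V) (z := op (T.obj (op k))) (y := op (S.obj (op k)))
    (x := op (S.obj (op l))) (natEval S T (op k)) (S.map (op l) (op k))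
  have e3 := (SymmetricCategory.symmetry_assoc (EnrichedCategory.Hom k l : V) (natObj S T)
    ((S.map (op l) (op k) ⊗ₘ natEval S T (op k)) ≫
      eComp V (S.obj (op l)) (S.obj (op k)) (T.obj (op k))))
  refine e1.trans ?_
  refine Eq.trans ?_ (congrArg (fun z => (β_ _ _).hom ≫ z) e2.symm)
  exact h1.symm.trans e3.symm

/-- The morphism `[K^op, A](S, T) ⟶ [K, A^op](T^op, S^op)`, which is the identity on components. -/
def opNat (S T : EnrichedFunctor V Kᵒᵖ A) : natObj S T ⟶ natObj (opDiagram T) (opDiagram S) :=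
  natLift _ (isNatural_op S T)

lemma opNat_eval (S T : EnrichedFunctor V Kᵒᵖ A) (k : K) :
    opNat S T ≫ natEval (opDiagram T) (opDiagram S) k = natEval S T (op k) :=
  natLift_eval _ (isNatural_op S T) k

lemma natId_opNat (S : EnrichedFunctor V Kᵒᵖ A) : natId S ≫ opNat S S = natId (opDiagram S) :=
  nat_hom_ext fun k => by
    rw [Category.assoc, opNat_eval]
    exact (natId_eval S (op k)).trans (natId_eval (opDiagram S) k).symm

lemma natComp_opNat (R S T : EnrichedFunctor V Kᵒᵖ A) :
    natComp R S T ≫ opNat R T = (β_ _ _).hom ≫ (opNat S T ⊗ₘ opNat R S) ≫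
      natComp (opDiagram T) (opDiagram S) (opDiagram R) :=
  nat_hom_ext fun k => by
    have e := tensorHom_eComp_op_eq (V := V) (z := op (T.obj (op k))) (y := op (S.obj (op k)))
      (x := op (R.obj (op k))) (natEval S T (op k)) (natEval R S (op k))
    simp only [Category.assoc]
    rw [opNat_eval, natComp_eval, tensorHom_comp_tensorHom_assoc, opNat_eval, opNat_eval]
    refine (natComp_eval R S T (op k)).trans ?_
    refine Eq.trans ?_ (congrArg (fun z => (β_ _ _).hom ≫ z) e.symm)
    exact (SymmetricCategory.symmetry_assoc _ _ _).symm

section colimFunctor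
variable (φ : EnrichedFunctor V K V)
  (hA : ∀ S : EnrichedFunctor V Kᵒᵖ A, ∃ c : WeightedCone φ (opDiagram S), c.IsLimit)

/-- A choice of the colimit `φ * S`, as a limit cone in `A^op`. -/
def colimCone (S : EnrichedFunctor V Kᵒᵖ A) : WeightedCone φ (opDiagram S) := (hA S).choose

lemma colimCone_isLimit (S : EnrichedFunctor V Kᵒᵖ A) : (colimCone φ hA S).IsLimit :=
  (hA S).choose_spec

/-- The morphism `[K^op, A](S, T) ⟶ A(φ * S, φ * T)`. -/
def colimMap (S T : EnrichedFunctor V Kᵒᵖ A) : natObj S T ⟶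
    EnrichedCategory.Hom (colimCone φ hA S).pt.unop (colimCone φ hA T).pt.unop :=
  opNat S T ≫ (colimCone_isLimit φ hA S).map (colimCone φ hA T)

lemma colimMap_id (S : EnrichedFunctor V Kᵒᵖ A) :
    natId S ≫ colimMap φ hA S S = eId V (colimCone φ hA S).pt.unop :=
  (Category.assoc _ _ _).symm.trans ((congrArg (fun z => z ≫ _) (natId_opNat S)).trans
    (colimCone_isLimit φ hA S).map_id)

lemma colimMap_comp (R S T : EnrichedFunctor V Kᵒᵖ A) :
    natComp R S T ≫ colimMap φ hA R T =
      (colimMap φ hA R S ⊗ₘ colimMap φ hA S T) ≫ eComp V (colimCone φ hA R).pt.unop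
        (colimCone φ hA S).pt.unop (colimCone φ hA T).pt.unop := by
  have e1 := (colimCone_isLimit φ hA S).map_comp (colimCone φ hA T) (colimCone_isLimit φ hA R)
  have e2 := tensorHom_eComp_op_eq (V := V) (colimMap φ hA S T) (colimMap φ hA R S)
  refine (Category.assoc _ _ _).symm.trans ((congrArg (fun z => z ≫ _)
    (natComp_opNat R S T)).trans ?_)
  simp only [Category.assoc]
  rw [e1, tensorHom_comp_tensorHom_assoc]
  refine (congrArg (fun z => (β_ _ _).hom ≫ z) e2).trans ?_
  exact SymmetricCategory.symmetry_assoc _ _ _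

/-- The `V`-functor `φ * - : [K^op, A] ⟶ A`, where `A` has all colimits weighted by `φ`. On
hom-objects it is determined by the universal property of `φ * S`. -/
def colimFunctor : EnrichedFunctor V (EnrichedFunctor V Kᵒᵖ A) A where
  obj S := (colimCone φ hA S).pt.unop
  map S T := colimMap φ hA S T
  map_id S := colimMap_id φ hA S
  map_comp R S T := colimMap_comp φ hA R S T

end colimFunctor

section Coend
variable [HasColimits V]
variable (φ : EnrichedFunctor V K V) (S : EnrichedFunctor V Kᵒᵖ V)

/-- The coend of `S k ⊗ φ k` exists. -/
lemma exists_coend : ∃ (L : V) (i : ∀ k : K, S.obj (op k) ⊗ φ.obj k ⟶ L),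
    (∀ k l : K, S.obj (op l) ◁ uncurry (φ.map k l) ≫ i l =
      S.obj (op l) ◁ (β_ _ _).hom ≫ (α_ _ _ _).inv ≫
        uncurry (S.map (op l) (op k)) ▷ φ.obj k ≫ i k) ∧
    (∀ (X : V) (f g : L ⟶ X), (∀ k, i k ≫ f = i k ≫ g) → f = g) ∧
    (∀ (X : V) (h : ∀ k, S.obj (op k) ⊗ φ.obj k ⟶ X),
      (∀ k l : K, S.obj (op l) ◁ uncurry (φ.map k l) ≫ h l =
        S.obj (op l) ◁ (β_ _ _).hom ≫ (α_ _ _ _).inv ≫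
          uncurry (S.map (op l) (op k)) ▷ φ.obj k ≫ h k) →
      ∃ f : L ⟶ X, ∀ k, i k ≫ f = h k) := by
  let E : K → V := fun k => S.obj (op k) ⊗ φ.obj k
  let R : K × K → V := fun p =>
    S.obj (op p.2) ⊗ φ.obj p.1 ⊗ (EnrichedCategory.Hom p.1 p.2 : V)
  let m₁ (p : K × K) : R p ⟶ E p.2 := S.obj (op p.2) ◁ uncurry (φ.map p.1 p.2)
  let m₂ (p : K × K) : R p ⟶ E p.1 := S.obj (op p.2) ◁ (β_ _ _).hom ≫ (α_ _ _ _).inv ≫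
    uncurry (S.map (op p.2) (op p.1)) ▷ φ.obj p.1
  let r₁ : (∐ R) ⟶ ∐ E := Limits.Sigma.desc fun p => m₁ p ≫ Sigma.ι E p.2
  let r₂ : (∐ R) ⟶ ∐ E := Limits.Sigma.desc fun p => m₂ p ≫ Sigma.ι E p.1
  refine ⟨coequalizer r₁ r₂, fun k => Sigma.ι E k ≫ coequalizer.π r₁ r₂, ?_, ?_, ?_⟩
  · intro k l
    have h := Sigma.ι R (k, l) ≫= coequalizer.condition r₁ r₂
    dsimp only [r₁, r₂] at h
    rw [Sigma.ι_desc_assoc, Sigma.ι_desc_assoc, Category.assoc, Category.assoc] at h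
    exact h.trans ((Category.assoc _ _ _).trans (congrArg _ (Category.assoc _ _ _)))
  · intro X f g h
    refine coequalizer.hom_ext (Sigma.hom_ext _ _ fun k => ?_)
    simpa only [Category.assoc] using h k
  · intro X h hh
    have w : r₁ ≫ Limits.Sigma.desc h = r₂ ≫ Limits.Sigma.desc h := by
      refine Sigma.hom_ext _ _ fun p => ?_
      dsimp only [r₁, r₂]
      rw [Sigma.ι_desc_assoc, Sigma.ι_desc_assoc, Category.assoc, Category.assoc,
        Sigma.ι_desc, Sigma.ι_desc]
      exact (hh p.1 p.2).trans
        ((Category.assoc _ _ _).trans (congrArg _ (Category.assoc _ _ _))).symm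
    refine ⟨coequalizer.desc (Limits.Sigma.desc h) w, fun k => ?_⟩
    rw [Category.assoc, coequalizer.π_desc, Sigma.ι_desc]

/-- `V` has all colimits with small weights. -/
lemma exists_colimit : ∃ c : WeightedCone φ (opDiagram S), c.IsLimit := by
  obtain ⟨L, i, hi, ext, desc⟩ := exists_coend φ S
  have key (X a : V) (f : X ⟶ (ihom L).obj a) (k : K) :
      uncurry ((curry (i k) ⊗ₘ f) ≫ eComp V (S.obj (op k)) L a) =
        (α_ _ _ _).inv ≫ i k ▷ X ≫ uncurry f := by
    rw [uncurry_eComp, uncurry_curry]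
  have nat (k l : K) : uncurry (φ.map k l) ≫ curry (i l) = (β_ _ _).hom ≫
      (S.map (op l) (op k) ⊗ₘ curry (i k)) ≫ eComp V (S.obj (op l)) (S.obj (op k)) L := by
    apply uncurry_injective
    have e2 := uncurry_eComp (S.map (op l) (op k)) (curry (i k))
    have e3 := uncurry_natural_left (β_ (φ.obj k) (EnrichedCategory.Hom k l)).hom
      ((S.map (op l) (op k) ⊗ₘ curry (i k)) ≫ eComp V (S.obj (op l)) (S.obj (op k)) L)
    refine Eq.trans ?_ e3.symm
    rw [uncurry_natural_left, uncurry_curry, hi k l]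
    rw [uncurry_curry] at e2
    exact congrArg (fun z => _ ◁ _ ≫ z) e2.symm
  let c : WeightedCone φ (opDiagram S) :=
    { pt := op L
      π := fun k => (curry (i k) : φ.obj k ⟶ (ihom (S.obj (op k))).obj L)
      naturality := fun k l => (nat k l).trans (tensorHom_eComp_op_eq (V := V) (z := op L)
        (y := op (S.obj (op k))) (x := op (S.obj (op l)))
        (curry (i k) : φ.obj k ⟶ (ihom (S.obj (op k))).obj L) (S.map (op l) (op k))).symm }
  have opc (X a : V) (f : X ⟶ (ihom L).obj a) (k : K) := tensorHom_eComp_op_eq (V := V)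
    (z := op a) (y := op L) (x := op (S.obj (op k))) f
    (curry (i k) : φ.obj k ⟶ (ihom (S.obj (op k))).obj L)
  have ex (a X : V) (s : ∀ k, φ.obj k ⊗ X ⟶ (ihom (S.obj (op k))).obj a)
      (hs : ∀ k l : K, (α_ _ _ _).inv ≫ uncurry (φ.map k l) ▷ X ≫ s l =
        φ.obj k ◁ (β_ _ _).hom ≫ (α_ _ _ _).inv ≫ (β_ _ _).hom ≫ (S.map (op l) (op k) ⊗ₘ s k) ≫
          eComp V (S.obj (op l)) (S.obj (op k)) a) :
      ∃ f : X ⟶ (ihom L).obj a, ∀ k,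
        (curry (i k) ⊗ₘ f) ≫ eComp V (S.obj (op k)) L a = s k := by
    obtain ⟨g, hg⟩ := desc ((ihom X).obj a)
      (fun k => curry ((β_ _ _).hom ≫ (α_ _ _ _).hom ≫ uncurry (s k))) (by
        intro k l
        have h0 := hs k l
        rw [Iso.inv_comp_eq] at h0
        have e1 := uncurry_natural_left (uncurry (φ.map k l) ▷ X) (s l)
        have e2 := uncurry_natural_left ((α_ (φ.obj k) (EnrichedCategory.Hom k l : V) X).hom ≫
          φ.obj k ◁ (β_ _ _).hom ≫ (α_ _ _ _).inv ≫ (β_ _ _).hom)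
          ((S.map (op l) (op k) ⊗ₘ s k) ≫ eComp V (S.obj (op l)) (S.obj (op k)) a)
        have e3 := uncurry_eComp (S.map (op l) (op k)) (s k)
        simp only [Category.assoc] at e2
        have e4 := e1.symm.trans ((congrArg uncurry h0).trans (e2.trans
          (congrArg (fun z => _ ◁ _ ≫ z) e3)))
        rw [← curry_natural_left, braiding_naturality_right_assoc,
          associator_naturality_middle_assoc]
        refine (congrArg (fun z => curry ((β_ _ _).hom ≫ (α_ _ _ _).hom ≫ z)) e4).trans ?_
        have e5 : S.obj (op l) ◁ (β_ (φ.obj k) (EnrichedCategory.Hom (op l) (op k) : V)).hom ≫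
            (α_ _ _ _).inv ≫ uncurry (S.map (op l) (op k)) ▷ φ.obj k ≫
              curry ((β_ X _).hom ≫ (α_ _ _ _).hom ≫ uncurry (s k)) =
            curry (X ◁ (S.obj (op l) ◁ (β_ _ _).hom ≫ (α_ _ _ _).inv ≫
              uncurry (S.map (op l) (op k)) ▷ φ.obj k) ≫
                (β_ X _).hom ≫ (α_ _ _ _).hom ≫ uncurry (s k)) := by
          rw [curry_natural_left]
          simp only [Category.assoc]
        refine Eq.trans ?_ e5.symm
        congr 1
        rw [braiding_naturality_right_assoc]
        congr 1
        have e6 : (α_ (φ.obj k) (EnrichedCategory.Hom k l : V) X).hom ≫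
            φ.obj k ◁ (β_ _ _).hom ≫ (α_ _ _ _).inv ≫ (β_ _ _).hom =
            (β_ _ _).hom ▷ X ≫ (α_ _ _ _).hom := by
          rw [braiding_tensor_left_hom]
          simp only [Iso.inv_hom_id_assoc]
          rw [← MonoidalCategory.whiskerLeft_comp_assoc, SymmetricCategory.symmetry]
          simp
        rw [e6]
        simp only [comp_whiskerRight, Category.assoc, MonoidalCategory.whiskerLeft_comp]
        monoidal)
    refine ⟨curry ((β_ _ _).hom ≫ uncurry g), fun k => ?_⟩
    apply uncurry_injective
    rw [key, uncurry_curry, braiding_naturality_left_assoc, ← uncurry_natural_left, hg,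
      uncurry_curry, SymmetricCategory.symmetry_assoc, Iso.inv_hom_id_assoc]
  have un (a X : V) (f g : X ⟶ (ihom L).obj a)
      (h : ∀ k, (curry (i k) ⊗ₘ f) ≫ eComp V (S.obj (op k)) L a =
        (curry (i k) ⊗ₘ g) ≫ eComp V (S.obj (op k)) L a) : f = g := by
    apply uncurry_injective
    rw [← cancel_epi (β_ X L).hom]
    apply curry_injective
    refine ext _ _ _ fun k => ?_
    have := congrArg uncurry (h k)
    rw [key, key, cancel_epi] at this
    rw [← curry_natural_left, ← curry_natural_left, braiding_naturality_right_assoc,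
      braiding_naturality_right_assoc, this]
  refine ⟨c, WeightedCone.isLimit_of ?_ ?_⟩
  · intro a X s hs
    obtain ⟨f, hf⟩ := ex a.unop X s (fun k l => (hs k l).trans (congrArg
      (fun z => _ ◁ _ ≫ (α_ _ _ _).inv ≫ z) (tensorHom_eComp_op_eq (V := V)
        (z := a) (y := op (S.obj (op k))) (x := op (S.obj (op l))) (s k) (S.map (op l) (op k)))))
    exact ⟨f, fun k => (opc X a.unop f k).trans (congrArg (fun z => (β_ _ _).hom ≫ z) (hf k))⟩
  · intro a X f g h
    refine un a.unop X f g fun k => ?_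
    have := ((opc X a.unop f k).symm.trans (h k)).trans (opc X a.unop g k)
    exact (cancel_epi _).1 this

end Coend

end Limits

section Classes
variable (V : Type u) [Category.{w} V] [MonoidalCategory V] [SymmetricCategory V] [MonoidalClosed V]

/-- A weight: a `V`-functor `φ : K ⟶ V` with small domain `K`. -/
structure Weight where
  /-- the domain -/
  dom : Type w
  /-- the enrichment of the domain -/
  [str : EnrichedCategory V dom]
  /-- the functor -/
  functor : EnrichedFunctor V dom V

attribute [instance] Weight.str

variable {V} [HasLimits V]

/-- `A` is `φ`-complete: it has a limit of every diagram with weight `φ`. -/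
def HasWeightedLimits (φ : Weight V) (A : Type u₁) [EnrichedCategory V A] : Prop :=
  ∀ T : EnrichedFunctor V φ.dom A, ∃ c : WeightedCone φ.functor T, c.IsLimit

/-- `F` preserves limits with weight `φ`: it sends limit cones to limit cones. -/
def PreservesWeightedLimits (φ : Weight V) {A : Type u₁} [EnrichedCategory V A]
    {B : Type u₂} [EnrichedCategory V B] (F : EnrichedFunctor V A B) : Prop :=
  ∀ (T : EnrichedFunctor V φ.dom A) (c : WeightedCone φ.functor T), c.IsLimit → (c.map F).IsLimit

/-- `A` is `Φ`-complete. -/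
def IsComplete (Φ : Set (Weight V)) (A : Type u₁) [EnrichedCategory V A] : Prop :=
  ∀ φ ∈ Φ, HasWeightedLimits φ A

/-- `F` preserves all limits with weights in `Φ`. -/
def IsContinuous (Φ : Set (Weight V)) {A : Type u₁} [EnrichedCategory V A]
    {B : Type u₂} [EnrichedCategory V B] (F : EnrichedFunctor V A B) : Prop :=
  ∀ φ ∈ Φ, PreservesWeightedLimits φ F

/-- The saturation `Φ^*`: the weights `ψ` such that every `Φ`-complete `V`-category is
`ψ`-complete and every `Φ`-continuous `V`-functor between `Φ`-complete `V`-categories is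
`ψ`-continuous. The `V`-categories are those whose objects form a type in a universe that contains
`V` and the small types and that may otherwise be arbitrarily large. -/
def saturation (Φ : Set (Weight V)) : Set (Weight V) :=
  {ψ | (∀ (A : Type (max u w v)) [EnrichedCategory V A],
      IsComplete Φ A → HasWeightedLimits ψ A) ∧
    ∀ (A B : Type (max u w v)) [EnrichedCategory V A] [EnrichedCategory V B]
      (F : EnrichedFunctor V A B), IsComplete Φ A → IsComplete Φ B → IsContinuous Φ F →
        PreservesWeightedLimits ψ F}

variable [HasColimits V]

/-- The `V`-functor `φ * - : [K^op, V] ⟶ V` for a weight `φ : K ⟶ V`. -/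
def weightedColim (φ : Weight V) : EnrichedFunctor V (EnrichedFunctor V φ.domᵒᵖ V) V :=
  colimFunctor φ.functor (exists_colimit φ.functor)

/-- `φ`-colimits commute with `ψ`-limits in `V`: the functor `φ * -` preserves `ψ`-limits. -/
def ColimitsCommuteLimits (φ ψ : Weight V) : Prop :=
  PreservesWeightedLimits ψ (weightedColim φ)

/-- `Ψ^+`: the `Ψ`-flat weights, whose colimits commute in `V` with limits with weights in `Ψ`. -/
def plus (Ψ : Set (Weight V)) : Set (Weight V) :=
  {φ | ∀ ψ ∈ Ψ, ColimitsCommuteLimits φ ψ}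

/-- `Φ^-`: the weights whose limits commute in `V` with colimits with weights in `Φ`. -/
def minus (Φ : Set (Weight V)) : Set (Weight V) :=
  {ψ | ∀ φ ∈ Φ, ColimitsCommuteLimits φ ψ}

end Classes
end EnrichedWeights
end

-- Commutation of `φ`-colimits with `ψ`-limits is symmetric in the two weights, and for one weight
-- held fixed it says that a single functor between complete categories is continuous. Saturation is
-- defined through such functors.
--
-- Fix `φ` with domain `K` and `ψ` with domain `M`. A diagram `M ⟶ [K^op, A]` is the same as a
-- two-variable functor `B`, and so is a diagram `K ⟶ [M^op, A^op]`. Limits and colimits in functor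
-- categories are pointwise, so `φ * -` preserves the `ψ`-limit of `B` exactly when the canonical
-- morphism `φ * {ψ, B} ⟶ {ψ, φ * B}` is invertible, and `{ψ, -}` preserves the `φ`-colimit of `B`
-- exactly when the same morphism is invertible (`Bifunctor.isLimit_map_iff`,
-- `preservesWeightedLimits_colimFunctor_iff`).
--
-- For fixed `φ`, the `ψ` that commute with it are the weights of limits preserved by `φ * - :
-- [K^op, V] ⟶ V`. Both categories have all small weighted limits (`exists_limit_self`,
-- `exists_limit_of_eval`), so a functor that is continuous for `Ψ` is continuous for the saturation
-- of `Ψ`. For fixed `ψ` the same argument applies to the opposite of `{ψ, -}`, with colimits in `V`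
-- (`exists_colimit`) supplying completeness. Since a class lies in its saturation, all four
-- equalities follow.
--
-- The functor `{ψ, -}` is obtained as a colimit functor on `[M^op, A^op]`, so that one
-- construction, `colimFunctor`, serves both sides. The price is a passage through `(A^op)^op`.

universe v₁ v₂

noncomputable section
namespace EnrichedWeights

/-! ### Isomorphisms in the underlying category of an enriched category. -/

section Inverse
variable {V : Type u} [Category.{w} V] [MonoidalCategory V]
variable {A : Type u₁} [EnrichedCategory V A]

/-- Two morphisms of the underlying category of `A` that are inverse to each other. -/
def AreInverse {a b : A} (f : 𝟙_ V ⟶ EnrichedCategory.Hom a b)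
    (g : 𝟙_ V ⟶ EnrichedCategory.Hom b a) : Prop :=
  (f ⊗ₘ g) ≫ eComp V a b a = (λ_ (𝟙_ V)).hom ≫ eId V a ∧
    (g ⊗ₘ f) ≫ eComp V b a b = (λ_ (𝟙_ V)).hom ≫ eId V b

/-- Composition in `Aᵒᵖ` is the braiding followed by composition in `A`, and the braiding of the
unit with itself is the identity. The two equations therefore just change places. -/
lemma AreInverse.unop [BraidedCategory V] {a b : A} {f : 𝟙_ V ⟶ EnrichedCategory.Hom a b}
    {g : 𝟙_ V ⟶ EnrichedCategory.Hom b a}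
    (h : AreInverse (A := Aᵒᵖ) (a := Opposite.op b) (b := Opposite.op a) f g) : AreInverse f g := by
  have e : (β_ (𝟙_ V) (𝟙_ V)).hom = 𝟙 _ := by
    rw [braiding_tensorUnit_left, ← unitors_inv_equal, Iso.hom_inv_id]
  obtain ⟨h1, h2⟩ := h
  have e1 := tensorHom_eComp_op_eq (V := V) (z := Opposite.op b) (y := Opposite.op a)
    (x := Opposite.op b) f g
  have e2 := tensorHom_eComp_op_eq (V := V) (z := Opposite.op a) (y := Opposite.op b)
    (x := Opposite.op a) g f
  rw [e, Category.id_comp] at e1 e2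
  exact ⟨e2.symm.trans h2, e1.symm.trans h1⟩

lemma AreInverse.op [BraidedCategory V] {a b : A} {f : 𝟙_ V ⟶ EnrichedCategory.Hom a b}
    {g : 𝟙_ V ⟶ EnrichedCategory.Hom b a} (h : AreInverse f g) :
    AreInverse (A := Aᵒᵖ) (a := op b) (b := op a) f g := by
  have e : (β_ (𝟙_ V) (𝟙_ V)).hom = 𝟙 _ := by
    rw [braiding_tensorUnit_left, ← unitors_inv_equal, Iso.hom_inv_id]
  constructor
  · refine (tensorHom_eComp_op_eq (V := V) (z := Opposite.op b) (y := Opposite.op a)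
      (x := Opposite.op b) f g).trans ?_
    rw [e, Category.id_comp]
    exact h.2
  · refine (tensorHom_eComp_op_eq (V := V) (z := Opposite.op a) (y := Opposite.op b)
      (x := Opposite.op a) g f).trans ?_
    rw [e, Category.id_comp]
    exact h.1

/-- Postcomposition with `f` is undone by postcomposition with its inverse `g`. -/
lemma AreInverse.comp_comp {a b c : A} {X : V} {f : 𝟙_ V ⟶ EnrichedCategory.Hom b c}
    {g : 𝟙_ V ⟶ EnrichedCategory.Hom c b} (h : AreInverse f g)
    (x : X ⟶ EnrichedCategory.Hom a b) :
    (((x ⊗ₘ f) ≫ eComp V a b c) ⊗ₘ g) ≫ eComp V a c b = (ρ_ _).hom ≫ (ρ_ _).hom ≫ x := by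
  rw [tensor_eComp_assoc, h.1, ← whiskerLeft_comp_tensorHom_assoc, tensor_eId_eComp]
  monoidal

/-- Precomposition with `f` is undone by precomposition with its inverse `g`. -/
lemma AreInverse.comp_comp' {a b c : A} {X : V} {f : 𝟙_ V ⟶ EnrichedCategory.Hom a b}
    {g : 𝟙_ V ⟶ EnrichedCategory.Hom b a} (h : AreInverse f g)
    (x : X ⟶ EnrichedCategory.Hom b c) :
    (g ⊗ₘ ((f ⊗ₘ x) ≫ eComp V a b c)) ≫ eComp V b a c = (λ_ _).hom ≫ (λ_ _).hom ≫ x := by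
  have e := tensor_eComp_assoc g f x
  rw [← Iso.inv_comp_eq, h.2, ← whiskerRight_comp_tensorHom_assoc, eId_tensor_eComp] at e
  rw [← e]
  monoidal

end Inverse

/-! ### Uniqueness of weighted limits and transport along isomorphisms. -/

section Limits
variable {V : Type u} [Category.{w} V] [MonoidalCategory V] [SymmetricCategory V] [MonoidalClosed V]
  [HasLimits V]
variable {K : Type w} [EnrichedCategory V K] {A : Type u₁} [EnrichedCategory V A]
  {B : Type u₂} [EnrichedCategory V B]

namespace WeightedCone
variable {φ : EnrichedFunctor V K V} {T : EnrichedFunctor V K A}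

/-- A morphism of cones, given by a morphism between the vertices. -/
def IsMorphism (d c : WeightedCone φ T) (f : 𝟙_ V ⟶ EnrichedCategory.Hom d.pt c.pt) : Prop :=
  ∀ k, (f ⊗ₘ c.π k) ≫ eComp V d.pt c.pt (T.obj k) = (λ_ (φ.obj k)).hom ≫ d.π k

variable {c d : WeightedCone φ T}

/-- The universal property at the generalized elements whose domain is the unit object. -/
lemma IsLimit.exists_isMorphism (hc : c.IsLimit) (d : WeightedCone φ T) :
    ∃ f, IsMorphism d c f := by
  obtain ⟨f, hf⟩ := hc.exists_lift (fun k => (ρ_ (φ.obj k)).hom ≫ d.π k) (fun k l => by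
    rw [rightUnitor_naturality_assoc, d.naturality, ← whiskerRight_comp_tensorHom_assoc,
      braiding_tensorUnit_right]
    simp)
  exact ⟨f, fun k => by simp [hf, braiding_tensorUnit_left]⟩

lemma IsMorphism.of_areInverse {f : 𝟙_ V ⟶ EnrichedCategory.Hom d.pt c.pt}
    {g : 𝟙_ V ⟶ EnrichedCategory.Hom c.pt d.pt} (hf : IsMorphism d c f) (h : AreInverse f g) :
    IsMorphism c d g := fun k => by
  have e := h.comp_comp' (c.π k)
  rw [hf k, ← whiskerLeft_comp_tensorHom_assoc, ← leftUnitor_naturality_assoc] at e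
  exact (cancel_epi _).1 e

/-- `g` followed by `f` is an endomorphism of the limit cone `c`, hence the identity. This is one
half of `AreInverse`; the other half needs `d` to be a limit as well. -/
lemma IsMorphism.areInverse {f : 𝟙_ V ⟶ EnrichedCategory.Hom d.pt c.pt}
    {g : 𝟙_ V ⟶ EnrichedCategory.Hom c.pt d.pt} (hf : IsMorphism d c f) (hg : IsMorphism c d g)
    (hc : c.IsLimit) : (g ⊗ₘ f) ≫ eComp V _ _ _ = (λ_ (𝟙_ V)).hom ≫ eId V c.pt :=
  hc.hom_ext fun k => by
    rw [tensor_eComp_assoc, hf k, ← whiskerLeft_comp_tensorHom_assoc, hg k,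
      ← whiskerRight_comp_tensorHom_assoc, eId_tensor_eComp]
    monoidal

lemma IsLimit.of_areInverse {f : 𝟙_ V ⟶ EnrichedCategory.Hom d.pt c.pt}
    {g : 𝟙_ V ⟶ EnrichedCategory.Hom c.pt d.pt} (hc : c.IsLimit) (hf : IsMorphism d c f)
    (h : AreInverse f g) : d.IsLimit := by
  have hg := hf.of_areInverse h
  refine isLimit_of ?_ ?_
  · intro a X s hs
    obtain ⟨x, hx⟩ := hc.exists_lift s hs
    -- The lift to `d` is the lift to `c` followed by `g`; the unitor absorbs the unit object on
    -- which `g` is defined.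
    refine ⟨(ρ_ X).inv ≫ (x ⊗ₘ g) ≫ eComp V _ _ _, fun k => ?_⟩
    rw [← whiskerRight_comp_tensorHom_assoc, tensor_eComp_assoc, hg k,
      ← whiskerLeft_comp_tensorHom_assoc, hx]
    monoidal
  · intro a X x y hxy
    -- After composition with `f` the legs of `c` separate the two elements, and `g` then undoes
    -- `f`.
    have e : (x ⊗ₘ f) ≫ eComp V _ _ _ = (y ⊗ₘ f) ≫ eComp V _ _ _ := hc.hom_ext fun k => by
      rw [tensor_eComp_assoc, tensor_eComp_assoc, hf k, ← whiskerLeft_comp_tensorHom_assoc,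
        ← whiskerLeft_comp_tensorHom_assoc, hxy]
    rw [← cancel_epi (ρ_ X).hom, ← cancel_epi (ρ_ (X ⊗ 𝟙_ V)).hom, ← h.comp_comp x, e,
      h.comp_comp y]

/-- A cone with a morphism `f` to a limit cone is a limit cone precisely when `f` is invertible. -/
lemma IsLimit.iff_exists_areInverse {f : 𝟙_ V ⟶ EnrichedCategory.Hom d.pt c.pt}
    (hc : c.IsLimit) (hf : IsMorphism d c f) : d.IsLimit ↔ ∃ g, AreInverse f g := by
  constructor
  · intro hd
    obtain ⟨g, hg⟩ := hd.exists_isMorphism c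
    exact ⟨g, hg.areInverse hf hd, hf.areInverse hg hc⟩
  · rintro ⟨g, h⟩
    exact hc.of_areInverse hf h

lemma IsMorphism.map {f : 𝟙_ V ⟶ EnrichedCategory.Hom d.pt c.pt} (hf : IsMorphism d c f)
    (F : EnrichedFunctor V A B) : IsMorphism (d.map F) (c.map F) (f ≫ F.map d.pt c.pt) := by
  intro k
  have h := hf k =≫ F.map d.pt (T.obj k)
  rw [Category.assoc, F.map_comp, tensorHom_comp_tensorHom_assoc, Category.assoc] at h
  exact h

lemma _root_.EnrichedWeights.AreInverse.map {a b : A} {f : 𝟙_ V ⟶ EnrichedCategory.Hom a b}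
    {g : 𝟙_ V ⟶ EnrichedCategory.Hom b a} (h : AreInverse f g) (F : EnrichedFunctor V A B) :
    AreInverse (f ≫ F.map a b) (g ≫ F.map b a) := by
  constructor
  · rw [← tensorHom_comp_tensorHom_assoc, ← F.map_comp, ← Category.assoc, h.1, Category.assoc,
      F.map_id]
  · rw [← tensorHom_comp_tensorHom_assoc, ← F.map_comp, ← Category.assoc, h.2, Category.assoc,
      F.map_id]

/-- Preservation of one limit cone over `T` implies the preservation of all of them. -/
lemma IsLimit.map_of_map (hc : c.IsLimit) (hd : d.IsLimit) {F : EnrichedFunctor V A B}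
    (h : (c.map F).IsLimit) : (d.map F).IsLimit := by
  obtain ⟨f, hf⟩ := hc.exists_isMorphism d
  obtain ⟨g, hg⟩ := (hc.iff_exists_areInverse hf).1 hd
  exact h.of_areInverse (hf.map F) (hg.map F)

/-- For cones over functors that agree only propositionally, such as a partial functor of `B` and
the evaluation of `B.left`. The legs are compared by `HEq` because their types mention both the
diagram and the vertex. -/
lemma IsLimit.congr {T' : EnrichedFunctor V K A} {c' : WeightedCone φ T'} (hc : c.IsLimit)
    (hT : T = T') (hpt : c.pt = c'.pt) (hπ : HEq c.π c'.π) : c'.IsLimit := by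
  subst hT
  obtain ⟨x, p, h⟩ := c
  obtain ⟨x', p', h'⟩ := c'
  obtain rfl : x = x' := hpt
  obtain rfl : p = p' := eq_of_heq hπ
  exact hc

end WeightedCone
end Limits

/-! ### Comparing a limit cone with a colimit cocone. -/

section Interchange
variable {V : Type u} [Category.{w} V] [MonoidalCategory V] [SymmetricCategory V] [MonoidalClosed V]
  [HasLimits V]
variable {M : Type w} [EnrichedCategory V M] {K : Type w} [EnrichedCategory V K]
  {A : Type u₁} [EnrichedCategory V A]

/-- Let `q` be the limit of `R`, let `j` be the colimit of `L`, and let `α` be a cone over `R`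
whose vertex is that of `j`, and `β` a cocone under `L` whose vertex is that of `q`. If both
induce the same morphisms `φ k ⊗ ψ m ⟶ A(L k, R m)`, then `α` is a limit if and only if `β` is a
colimit, since both say that the induced morphism from `colim L` to `lim R` is invertible. -/
lemma isLimit_iff_isLimit_of_compatible {φ : EnrichedFunctor V K V} {ψ : EnrichedFunctor V M V}
    {R : EnrichedFunctor V M A} {L : EnrichedFunctor V K Aᵒᵖ}
    {q : WeightedCone ψ R} {j : WeightedCone φ L} (hq : q.IsLimit) (hj : j.IsLimit)
    (α : ∀ m, ψ.obj m ⟶ (EnrichedCategory.Hom j.pt.unop (R.obj m) : V))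
    (hα : ∀ m m', uncurry (ψ.map m m') ≫ α m' = (α m ⊗ₘ R.map m m') ≫ eComp V _ _ _)
    (β : ∀ k, φ.obj k ⟶ (EnrichedCategory.Hom (op q.pt) (L.obj k) : V))
    (hβ : ∀ k k', uncurry (φ.map k k') ≫ β k' = (β k ⊗ₘ L.map k k') ≫ eComp V _ _ _)
    (w : ∀ k m,
      ((j.π k : φ.obj k ⟶ EnrichedCategory.Hom (L.obj k).unop j.pt.unop) ⊗ₘ α m) ≫
          eComp V (L.obj k).unop j.pt.unop (R.obj m) =
      ((β k : φ.obj k ⟶ EnrichedCategory.Hom (L.obj k).unop q.pt) ⊗ₘ q.π m) ≫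
          eComp V (L.obj k).unop q.pt (R.obj m)) :
    (WeightedCone.mk j.pt.unop α hα).IsLimit ↔ (WeightedCone.mk (op q.pt) β hβ).IsLimit := by
  obtain ⟨f, hf⟩ := hq.exists_isMorphism ⟨_, α, hα⟩
  -- Read in `Aᵒᵖ`, the same `f` is a morphism of cones from `β` to `j`. Tested against the legs of
  -- `q`, this is the compatibility `w`.
  have hf' : WeightedCone.IsMorphism (⟨_, β, hβ⟩ : WeightedCone φ L) j f := by
    intro k
    refine (tensorHom_eComp_op_eq (V := V) (z := op q.pt) (y := j.pt) (x := L.obj k)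
      f (j.π k)).trans ?_
    rw [← cancel_epi (β_ _ _).hom, SymmetricCategory.symmetry_assoc]
    refine hq.hom_ext fun m => ?_
    refine (tensor_eComp_assoc (C := A) _ _ _).trans ?_
    have e : (f ⊗ₘ q.π m) ≫ eComp V j.pt.unop q.pt (R.obj m) = (λ_ (ψ.obj m)).hom ≫ α m := hf m
    rw [e, ← whiskerLeft_comp_tensorHom_assoc]
    refine (congrArg (fun z => _ ≫ _ ≫ z) (w k m)).trans ?_
    rw [braiding_tensorUnit_right]
    simp only [Category.assoc, Iso.inv_hom_id_assoc]
    refine Eq.trans ?_ (congrArg (fun z => z ≫ _) (whiskerRight_comp_tensorHom _ _ _))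
    simp
  -- Each side now says that `f` is invertible, in `A` and in `Aᵒᵖ` respectively.
  rw [hq.iff_exists_areInverse hf, hj.iff_exists_areInverse hf']
  exact ⟨fun ⟨g, h⟩ => ⟨g, h.op⟩, fun ⟨g, h⟩ => ⟨g, h.unop⟩⟩

end Interchange

/-! ### Pointwise limits in functor categories. -/

section Pointwise
variable {V : Type u} [Category.{w} V] [MonoidalCategory V] [SymmetricCategory V] [MonoidalClosed V]
  [HasLimits V]
variable {M : Type w} [EnrichedCategory V M] {K : Type w} [EnrichedCategory V K]
  {A : Type u₁} [EnrichedCategory V A]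

/-- Evaluation at `k`, as a `V`-functor `[K, A] ⟶ A`. -/
@[reducible]
def evalFunctor (k : K) : EnrichedFunctor V (EnrichedFunctor V K A) A where
  obj F := F.obj k
  map F G := natEval F G k
  map_id F := natId_eval F k
  map_comp F G H := natComp_eval F G H k

lemma tensor_natEval {F G H : EnrichedFunctor V K A} {X Y : V} (f : X ⟶ natObj F G)
    (g : Y ⟶ natObj G H) (k : K) :
    ((f ⊗ₘ g) ≫ eComp V F G H) ≫ natEval F H k =
      ((f ≫ natEval F G k) ⊗ₘ (g ≫ natEval G H k)) ≫
        eComp V (F.obj k) (G.obj k) (H.obj k) := by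
  rw [Category.assoc, ← tensorHom_comp_tensorHom_assoc, ← natComp_eval]
  rfl

variable {ψ : EnrichedFunctor V M V} {T : EnrichedFunctor V M (EnrichedFunctor V K A)}

/-- The universal property of a limit makes the limits of the diagrams `T - k` functorial in `k`. -/
lemma exists_limit_map (c : ∀ k, WeightedCone ψ (T.comp V (evalFunctor k)))
    (hc : ∀ k, (c k).IsLimit) (k l : K) :
    ∃ f : EnrichedCategory.Hom k l ⟶ EnrichedCategory.Hom (c k).pt (c l).pt, ∀ m,
      (f ⊗ₘ (c l).π m) ≫ eComp V (c k).pt (c l).pt ((T.obj m).obj l) =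
        (β_ _ _).hom ≫ ((c k).π m ⊗ₘ (T.obj m).map k l) ≫
          eComp V (c k).pt ((T.obj m).obj k) ((T.obj m).obj l) := by
  refine (hc l).exists_lift (fun m => ((c k).π m ⊗ₘ (T.obj m).map k l) ≫
    eComp V (c k).pt ((T.obj m).obj k) ((T.obj m).obj l)) fun m n => ?_
  have h := natEval_natural (T.map m n) k l
  have e := (c k).naturality m n
  dsimp only [EnrichedFunctor.comp] at h e ⊢
  rw [whiskerRight_comp_tensorHom_assoc, e, tensor_eComp_assoc, tensor_eComp_assoc, h,
    Iso.inv_hom_id_assoc, Iso.inv_hom_id_assoc, whiskerLeft_comp_tensorHom_assoc,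
    SymmetricCategory.symmetry_assoc]

/-- The hom-objects of `[K, A]` are ends, so an element of one is a natural family. Lifts exist and
are unique at each `k`; the only thing to prove is that the lifts form a natural family. -/
lemma isLimit_of_eval {c : WeightedCone ψ T}
    (h : ∀ k, (c.map (evalFunctor k)).IsLimit) : c.IsLimit := by
  have ext (k : K) {a : A} {X : V} (x y : X ⟶ EnrichedCategory.Hom a (c.pt.obj k))
      (e : ∀ m, (x ⊗ₘ (c.π m ≫ natEval c.pt (T.obj m) k)) ≫
        eComp V a (c.pt.obj k) ((T.obj m).obj k) = (y ⊗ₘ (c.π m ≫ natEval c.pt (T.obj m) k)) ≫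
        eComp V a (c.pt.obj k) ((T.obj m).obj k)) : x = y := (h k).hom_ext e
  refine WeightedCone.isLimit_of ?_ ?_
  · intro F X s hs
    have h1 (k : K) : ∃ f : X ⟶ EnrichedCategory.Hom (F.obj k) (c.pt.obj k), ∀ m,
        (f ⊗ₘ (c.π m ≫ natEval c.pt (T.obj m) k)) ≫
          eComp V (F.obj k) (c.pt.obj k) ((T.obj m).obj k) =
        (β_ X (ψ.obj m)).hom ≫ s m ≫ natEval F (T.obj m) k :=
      (h k).exists_lift (a := F.obj k) (fun m => s m ≫ natEval F (T.obj m) k) (by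
        intro m n
        have e := hs m n =≫ natEval F (T.obj n) k
        have e' := tensor_natEval (s m) (T.map m n) k
        simp only [Category.assoc] at e e'
        refine e.trans ?_
        congr 2)
    choose f hf using h1
    -- Uniqueness at `l` reduces naturality to the legs, where it follows from the naturality in `k`
    -- of `s m` and of `c.π m`.
    have nat : IsNatural F c.pt f := by
      intro k l
      refine ext l _ _ fun m => ?_
      have e1 := tensor_eComp_assoc (f k) (c.π m ≫ natEval c.pt (T.obj m) k) ((T.obj m).map k l)
      rw [hf k m, ← Iso.inv_comp_eq] at e1
      rw [tensor_eComp_assoc, hf l m, ← whiskerLeft_comp_tensorHom_assoc,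
        natEval_natural (s m) k l,
        ← whiskerRight_comp_tensorHom_assoc (β_ (EnrichedCategory.Hom k l) X).hom,
        tensor_eComp_assoc, natEval_natural (c.π m) k l,
        ← whiskerLeft_comp_tensorHom_assoc (f k), ← e1,
        ← whiskerRight_comp_tensorHom_assoc (β_ X (ψ.obj m)).hom, braiding_naturality_right_assoc,
        braiding_tensor_right_hom]
      simp only [Category.assoc, Iso.hom_inv_id_assoc]
    refine ⟨natLift f nat, fun m => nat_hom_ext fun k => ?_⟩
    rw [tensor_natEval, natLift_eval, Category.assoc, hf k m]
  · intro F X f g e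
    refine nat_hom_ext fun k => ext k _ _ fun m => ?_
    have e1 := e m =≫ natEval F (T.obj m) k
    rwa [tensor_natEval, tensor_natEval] at e1

/-- The chosen limits for the various `k` form a functor by uniqueness of lifts, and their legs form
a cone in `[K, A]` whose evaluations are the chosen limit cones. -/
lemma exists_limit_of_eval (h : ∀ k, ∃ c : WeightedCone ψ (T.comp V (evalFunctor k)), c.IsLimit) :
    ∃ c : WeightedCone ψ T, c.IsLimit := by
  -- Vertices, legs and induced maps are unpacked into separate data, with types free of `T.comp V
  -- (evalFunctor k)`, so that the equations below can be rewritten.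
  obtain ⟨L₀, p, hp, f, hf, hL⟩ : ∃ (L₀ : K → A)
      (p : ∀ k m, ψ.obj m ⟶ (EnrichedCategory.Hom (L₀ k) ((T.obj m).obj k) : V))
      (hp : ∀ k m n, uncurry (ψ.map m n) ≫ p k n =
        (p k m ⊗ₘ (T.map m n ≫ natEval (T.obj m) (T.obj n) k)) ≫
          eComp V (L₀ k) ((T.obj m).obj k) ((T.obj n).obj k))
      (f : ∀ k l, EnrichedCategory.Hom k l ⟶ (EnrichedCategory.Hom (L₀ k) (L₀ l) : V)),
      (∀ k l m, (f k l ⊗ₘ p l m) ≫ eComp V (L₀ k) (L₀ l) ((T.obj m).obj l) =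
        (β_ _ _).hom ≫ (p k m ⊗ₘ (T.obj m).map k l) ≫
          eComp V (L₀ k) ((T.obj m).obj k) ((T.obj m).obj l)) ∧
      ∀ k, (⟨L₀ k, p k, hp k⟩ : WeightedCone ψ (T.comp V (evalFunctor k))).IsLimit := by
    choose c hc using h
    choose f hf using exists_limit_map c hc
    exact ⟨fun k => (c k).pt, fun k => (c k).π, fun k => (c k).naturality, f, hf, hc⟩
  have ext (k : K) {a : A} {X : V} (x y : X ⟶ EnrichedCategory.Hom a (L₀ k))
      (e : ∀ m, (x ⊗ₘ p k m) ≫ eComp V a (L₀ k) ((T.obj m).obj k) =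
        (y ⊗ₘ p k m) ≫ eComp V a (L₀ k) ((T.obj m).obj k)) : x = y := (hL k).hom_ext e
  -- Both functor laws are checked on the legs, where they become the functor laws of `T.obj m`.
  let L : EnrichedFunctor V K A :=
    { obj := L₀
      map := f
      map_id := fun k => ext k _ _ fun m => by
        rw [← whiskerRight_comp_tensorHom_assoc, hf, eId_tensor_eComp,
          braiding_naturality_left_assoc, whiskerLeft_comp_tensorHom_assoc, (T.obj m).map_id,
          tensor_eId_eComp, braiding_tensorUnit_left]
        simp
      map_comp := fun k l n => ext n _ _ fun m => by
        have e1 := tensor_eComp_assoc (p k m) ((T.obj m).map k l) ((T.obj m).map l n)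
        have e2 := tensor_eComp_assoc (f k l) (p l m) ((T.obj m).map l n)
        rw [← Iso.inv_comp_eq] at e1 e2
        rw [← whiskerRight_comp_tensorHom_assoc, hf, braiding_naturality_left_assoc,
          whiskerLeft_comp_tensorHom_assoc, (T.obj m).map_comp, tensor_eComp_assoc, hf l n m,
          ← whiskerLeft_comp_tensorHom_assoc (f k l), ← e2, hf k l m,
          ← whiskerRight_comp_tensorHom_assoc (β_ _ _).hom, ← e1, braiding_tensor_left_hom]
        simp only [Category.assoc, Iso.hom_inv_id_assoc] }
  have nat (m : M) : IsNatural L (T.obj m) (fun k => p k m) := fun k l => hf k l m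
  let π (m : M) : ψ.obj m ⟶ natObj L (T.obj m) := natLift _ (nat m)
  have hπ (m : M) (k : K) : π m ≫ natEval L (T.obj m) k = p k m := natLift_eval _ (nat m) k
  let d : WeightedCone ψ T :=
    { pt := L
      π := π
      naturality := fun m n => nat_hom_ext fun k => by
        rw [tensor_natEval, Category.assoc, hπ, hπ]
        exact hp k m n }
  refine ⟨d, isLimit_of_eval fun k => ?_⟩
  have e : d.map (evalFunctor k) = ⟨L₀ k, p k, hp k⟩ := by
    have e' : (d.map (evalFunctor k)).π = p k := funext fun m => hπ m k
    -- The legs are generalized to a variable `q` so that the equality `e'` can be substituted under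
    -- the naturality proof.
    have e'' (q : ∀ m, ψ.obj m ⟶ (EnrichedCategory.Hom (L₀ k) ((T.obj m).obj k) : V)) (h1 h2)
        (hq : q = p k) : (⟨L₀ k, q, h1⟩ : WeightedCone ψ (T.comp V (evalFunctor k))) =
          ⟨L₀ k, p k, h2⟩ := by subst hq; rfl
    exact e'' _ _ _ e'
  rw [e]
  exact hL k

lemma hasWeightedLimits_functorCategory {ψ : Weight V} (h : HasWeightedLimits ψ A) :
    HasWeightedLimits ψ (EnrichedFunctor V K A) :=
  fun _ => exists_limit_of_eval fun _ => h _

end Pointwise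

/-! ### Opposite functors and the double opposite. -/

section DoubleOp
variable {V : Type u} [Category.{w} V] [MonoidalCategory V] [SymmetricCategory V]
variable {M : Type w} [EnrichedCategory V M] {K : Type w} [EnrichedCategory V K]
  {A : Type u₁} [EnrichedCategory V A]

/-- The `V`-functor `R^op : M^op ⟶ A^op`. -/
@[reducible]
def opFunctor (R : EnrichedFunctor V M A) : EnrichedFunctor V Mᵒᵖ Aᵒᵖ where
  obj m := op (R.obj m.unop)
  map m n := R.map n.unop m.unop
  map_id m := R.map_id m.unop
  map_comp k l m := by
    refine (Category.assoc _ _ _).trans ((congrArg (fun z => _ ≫ z) (R.map_comp _ _ _)).trans ?_)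
    exact (tensorHom_eComp_op_eq (V := V) (z := op (R.obj k.unop)) (y := op (R.obj l.unop))
      (x := op (R.obj m.unop)) (R.map l.unop k.unop) (R.map m.unop l.unop)).symm

/-- The `V`-functor `K^op ⟶ A` corresponding to `L : K ⟶ A^op`. -/
@[reducible]
def unopDiagram (L : EnrichedFunctor V K Aᵒᵖ) : EnrichedFunctor V Kᵒᵖ A where
  obj k := (L.obj k.unop).unop
  map k l := L.map l.unop k.unop
  map_id k := L.map_id k.unop
  map_comp k l m := by
    refine (Category.assoc _ _ _).trans ((congrArg (fun z => _ ≫ z) (L.map_comp _ _ _)).trans ?_)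
    refine (congrArg (fun z => _ ≫ z) (tensorHom_eComp_op_eq (V := V)
      (L.map m.unop l.unop) (L.map l.unop k.unop))).trans ?_
    exact SymmetricCategory.symmetry_assoc _ _ _

/-- The `V`-functor `M ⟶ A` corresponding to `S : M^op ⟶ A^op`. -/
@[reducible]
def unopFunctor (S : EnrichedFunctor V Mᵒᵖ Aᵒᵖ) : EnrichedFunctor V M A where
  obj m := (S.obj (op m)).unop
  map m n := S.map (op n) (op m)
  map_id m := S.map_id (op m)
  map_comp k l m := by
    rw [← cancel_epi (β_ _ _).hom]
    refine (Category.assoc _ _ _).symm.trans ((S.map_comp (op m) (op l) (op k)).trans ?_)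
    exact tensorHom_eComp_op_eq (V := V) (S.map (op m) (op l)) (S.map (op l) (op k))

/-- The diagram `R : M ⟶ A`, regarded as a diagram in `(A^op)^op`. -/
abbrev doubleOp (R : EnrichedFunctor V M A) : EnrichedFunctor V M Aᵒᵖᵒᵖ :=
  opDiagram (opFunctor R)

/-- Each passage to the opposite inserts a braiding, and two of them cancel by symmetry. Hence
`(A^op)^op` has the composition of `A`, though not by definition. -/
lemma tensor_eComp_op_op {a b c : Aᵒᵖᵒᵖ} {X Y : V} (f : X ⟶ EnrichedCategory.Hom a b)
    (g : Y ⟶ EnrichedCategory.Hom b c) :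
    (f ⊗ₘ g) ≫ eComp V a b c =
      ((f : X ⟶ EnrichedCategory.Hom a.unop.unop b.unop.unop) ⊗ₘ
        (g : Y ⟶ EnrichedCategory.Hom b.unop.unop c.unop.unop)) ≫
        eComp V a.unop.unop b.unop.unop c.unop.unop := by
  refine (tensorHom_eComp_op_eq (V := V) f g).trans ?_
  refine (congrArg (fun z => _ ≫ z) (tensorHom_eComp_op_eq (V := V) (z := c.unop) (y := b.unop)
    (x := a.unop) g f)).trans ?_
  exact SymmetricCategory.symmetry_assoc _ _ _

variable [MonoidalClosed V] [HasLimits V]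

/-- The hom-objects agree and composition agrees by `tensor_eComp_op_op`, so the two universal
properties are the same. This identifies a colimit in `A^op` with a limit in `A`. -/
lemma isLimit_doubleOp_iff {ψ : EnrichedFunctor V M V} {R : EnrichedFunctor V M A} {x : A}
    {p : ∀ m, ψ.obj m ⟶ (EnrichedCategory.Hom x (R.obj m) : V)} {h₁ h₂} :
    (⟨x, p, h₁⟩ : WeightedCone ψ R).IsLimit ↔
      (⟨op (op x), p, h₂⟩ : WeightedCone ψ (doubleOp R)).IsLimit := by
  constructor
  · intro h
    refine WeightedCone.isLimit_of ?_ ?_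
    · intro a X s hs
      obtain ⟨f, hf⟩ := h.exists_lift (a := a.unop.unop) (X := X) s (fun k l =>
        (hs k l).trans (congrArg (fun z => _ ≫ _ ≫ z) (tensor_eComp_op_op (a := a)
          (b := op (op (R.obj k))) (c := op (op (R.obj l))) (s k) (R.map k l))))
      exact ⟨f, fun k => (tensor_eComp_op_op (a := a) (b := op (op x)) (c := op (op (R.obj k)))
        f (p k)).trans (hf k)⟩
    · intro a X f g e
      refine h.hom_ext (a := a.unop.unop) (f := f) (g := g) fun k => ?_
      exact (tensor_eComp_op_op (a := a) (b := op (op x)) (c := op (op (R.obj k)))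
        f (p k)).symm.trans ((e k).trans (tensor_eComp_op_op (a := a) (b := op (op x))
          (c := op (op (R.obj k))) g (p k)))
  · intro h
    refine WeightedCone.isLimit_of ?_ ?_
    · intro a X s hs
      obtain ⟨f, hf⟩ := h.exists_lift (a := op (op a)) (X := X) s (fun k l =>
        (hs k l).trans (congrArg (fun z => _ ≫ _ ≫ z) (tensor_eComp_op_op (a := op (op a))
          (b := op (op (R.obj k))) (c := op (op (R.obj l))) (s k) (R.map k l)).symm))
      exact ⟨f, fun k => (tensor_eComp_op_op (a := op (op a)) (b := op (op x))
        (c := op (op (R.obj k))) f (p k)).symm.trans (hf k)⟩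
    · intro a X f g e
      refine h.hom_ext (a := op (op a)) (f := f) (g := g) fun k => ?_
      exact (tensor_eComp_op_op (a := op (op a)) (b := op (op x)) (c := op (op (R.obj k)))
        f (p k)).trans ((e k).trans (tensor_eComp_op_op (a := op (op a)) (b := op (op x))
          (c := op (op (R.obj k))) g (p k)).symm)

lemma doubleOp_naturality_iff {ψ : EnrichedFunctor V M V} {R : EnrichedFunctor V M A} {x : A}
    {p : ∀ m, ψ.obj m ⟶ (EnrichedCategory.Hom x (R.obj m) : V)} {m n : M} :
    uncurry (ψ.map m n) ≫ p n = (p m ⊗ₘ R.map m n) ≫ eComp V x (R.obj m) (R.obj n) ↔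
    uncurry (ψ.map m n) ≫ p n =
      ((p m : ψ.obj m ⟶ EnrichedCategory.Hom (op (op x)) (op (op (R.obj m)))) ⊗ₘ
        (doubleOp R).map m n) ≫ eComp V (op (op x)) (op (op (R.obj m))) (op (op (R.obj n))) := by
  have e := tensor_eComp_op_op (V := V) (a := op (op x)) (b := op (op (R.obj m)))
    (c := op (op (R.obj n))) (p m) (R.map m n)
  exact ⟨fun h => h.trans e.symm, fun h => h.trans e⟩

/-- A limit of `M ⟶ A`, regarded as a colimit of `M^op ⟶ A^op`. -/
lemma exists_limit_opDiagram {ψ : EnrichedFunctor V M V}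
    (hA : ∀ R : EnrichedFunctor V M A, ∃ c : WeightedCone ψ R, c.IsLimit)
    (S : EnrichedFunctor V Mᵒᵖ Aᵒᵖ) : ∃ c : WeightedCone ψ (opDiagram S), c.IsLimit := by
  obtain ⟨⟨x, p, h⟩, hc⟩ := hA (unopFunctor S)
  exact ⟨(⟨op (op x), p, fun m n => doubleOp_naturality_iff.1 (h m n)⟩ :
    WeightedCone ψ (doubleOp (unopFunctor S))), isLimit_doubleOp_iff.1 hc⟩

end DoubleOp

/-! ### Small weighted limits in `V`. -/

section Self
variable {V : Type u} [Category.{w} V] [MonoidalCategory V] [SymmetricCategory V]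

/-- The isomorphism `p ⊗ (a ⊗ x) ≅ a ⊗ (p ⊗ x)`, as a morphism. -/
def swapLeft (p a x : V) : p ⊗ a ⊗ x ⟶ a ⊗ p ⊗ x :=
  (α_ _ _ _).inv ≫ (β_ p a).hom ▷ x ≫ (α_ _ _ _).hom

lemma swapLeft_naturality {p q : V} (f : p ⟶ q) (a x : V) :
    f ▷ (a ⊗ x) ≫ swapLeft q a x = swapLeft p a x ≫ a ◁ f ▷ x := by
  simp only [swapLeft, Category.assoc]
  rw [associator_inv_naturality_left_assoc, ← comp_whiskerRight_assoc, braiding_naturality_left]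
  simp

lemma braiding_swapLeft (p a x : V) :
    (α_ a x p).inv ≫ (β_ (a ⊗ x) p).hom ≫ swapLeft p a x = a ◁ (β_ x p).hom := by
  rw [braiding_tensor_left_hom, swapLeft]
  simp [← comp_whiskerRight_assoc]

/-- Moving `a` past `p ⊗ k` is moving it past each factor (hexagon); the two remaining braidings act
on disjoint factors and can be exchanged. It gives naturality of the transposed family in
`exists_limit_self`. -/
lemma swapLeft_tensor (p k a x : V) :
    (α_ p k (a ⊗ x)).inv ≫ swapLeft (p ⊗ k) a x ≫
      a ◁ ((α_ p k x).hom ≫ p ◁ (β_ k x).hom ≫ (α_ p x k).inv) ≫ (α_ a (p ⊗ x) k).inv =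
    p ◁ (β_ k (a ⊗ x)).hom ≫ (α_ p (a ⊗ x) k).inv ≫ swapLeft p a x ▷ k := by
  rw [swapLeft, swapLeft, braiding_tensor_left_hom, braiding_tensor_right_hom]
  trans p ◁ ((α_ k a x).inv ≫ (β_ k a).hom ▷ x ≫ (α_ a k x).hom) ≫ (α_ p a (k ⊗ x)).inv ≫
    ((β_ p a).hom ▷ (k ⊗ x) ≫ (a ⊗ p) ◁ (β_ k x).hom) ≫ (α_ a p (x ⊗ k)).hom ≫
      a ◁ (α_ p x k).inv ≫ (α_ a (p ⊗ x) k).inv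
  · monoidal
  · rw [← whisker_exchange]
    monoidal

variable [MonoidalClosed V] [HasLimits V] {K : Type w} [EnrichedCategory V K]

/-- `V` has all limits with small weights: `{ψ, T}` is the hom-object `[K, V](ψ, T)`. -/
lemma exists_limit_self (ψ T : EnrichedFunctor V K V) :
    ∃ c : WeightedCone ψ T, c.IsLimit := by
  let L : V := natObj ψ T
  let e (k : K) : ψ.obj k ⊗ L ⟶ T.obj k := uncurry (natEval ψ T k)
  have he (k l : K) : (α_ _ _ _).inv ≫ uncurry (ψ.map k l) ▷ L ≫ e l =
      ψ.obj k ◁ (β_ _ _).hom ≫ (α_ _ _ _).inv ≫ e k ▷ _ ≫ uncurry (T.map k l) := by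
    have e1 := uncurry_eComp (ψ.map k l) (natEval ψ T l)
    have e2 := uncurry_eComp (natEval ψ T k) (T.map k l)
    refine e1.symm.trans ((congrArg uncurry (isNatural_eval k l)).trans ?_)
    exact (uncurry_natural_left _ _).trans (congrArg (fun z => _ ≫ z) e2)
  -- The counit is evaluation at `k` with its two arguments exchanged.
  let p (k : K) : ψ.obj k ⟶ (ihom L).obj (T.obj k) := curry ((β_ _ _).hom ≫ e k)
  have hp (k l : K) : uncurry (ψ.map k l) ≫ p l = (p k ⊗ₘ T.map k l) ≫ eComp V L _ _ := by
    apply uncurry_injective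
    refine Eq.trans ?_ (uncurry_eComp _ _).symm
    rw [uncurry_natural_left, uncurry_curry, uncurry_curry, braiding_naturality_right_assoc]
    have h := he k l
    rw [Iso.inv_comp_eq] at h
    rw [h]
    rw [braiding_tensor_right_hom]
    simp only [Category.assoc, Iso.inv_hom_id_assoc, ← MonoidalCategory.whiskerLeft_comp_assoc,
      SymmetricCategory.symmetry, MonoidalCategory.whiskerLeft_id, Category.id_comp,
      Iso.hom_inv_id_assoc, comp_whiskerRight]
  -- Composing with the counit is, up to transposition, evaluation at `k`. Both halves of the
  -- universal property thus reduce to that of the end `L`.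
  have key {a X : V} (f : X ⟶ (ihom a).obj L) (k : K) :
      uncurry ((f ⊗ₘ p k) ≫ eComp V a L (T.obj k)) =
        (α_ _ _ _).inv ≫ (β_ _ _).hom ≫ ψ.obj k ◁ uncurry f ≫ e k := by
    refine (uncurry_eComp _ _).trans ?_
    rw [uncurry_curry, braiding_naturality_left_assoc]
  refine ⟨⟨L, p, hp⟩, WeightedCone.isLimit_of ?_ ?_⟩
  · intro a X s hs
    -- Transposing `s k` with respect to `a` gives a natural family on `a ⊗ X`, that is, a morphism
    -- `a ⊗ X ⟶ L`; the required lift is its transpose.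
    let s' (k : K) : ψ.obj k ⊗ a ⊗ X ⟶ T.obj k := swapLeft _ _ _ ≫ uncurry (s k)
    have hs' := isNatural_of_uncurry s' (by
      intro k l
      have h := congrArg uncurry (hs k l)
      have e1 := uncurry_eComp (s k) (T.map k l)
      have e2 := uncurry_natural_left ((α_ (ψ.obj k) (EnrichedCategory.Hom k l) X).inv ≫
        uncurry (ψ.map k l) ▷ X) (s l)
      have e3 := uncurry_natural_left (ψ.obj k ◁ (β_ (EnrichedCategory.Hom k l) X).hom ≫
        (α_ _ _ _).inv) ((s k ⊗ₘ T.map k l) ≫ eComp V a (T.obj k) (T.obj l))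
      simp only [Category.assoc] at e2 e3
      have h' := e2.symm.trans (h.trans (e3.trans (congrArg (fun z => _ ≫ z) e1)))
      have h1 := swapLeft_naturality (uncurry (ψ.map k l)) a X =≫ uncurry (s l)
      simp only [Category.assoc] at h1
      rw [h1]
      dsimp only [s']
      have h2 : a ◁ uncurry (ψ.map k l) ▷ X ≫ uncurry (s l) =
          a ◁ ((α_ (ψ.obj k) (EnrichedCategory.Hom k l) X).hom ≫
            ψ.obj k ◁ (β_ (EnrichedCategory.Hom k l) X).hom ≫
              (α_ (ψ.obj k) X (EnrichedCategory.Hom k l)).inv) ≫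
            (α_ a (ψ.obj k ⊗ X) (EnrichedCategory.Hom k l)).inv ≫
              uncurry (s k) ▷ _ ≫ uncurry (T.map k l) := by
        rw [MonoidalCategory.whiskerLeft_comp, Category.assoc, ← h']
        simp
      rw [h2, comp_whiskerRight, Category.assoc]
      have h3 := swapLeft_tensor (ψ.obj k) (EnrichedCategory.Hom k l) a X =≫
        (uncurry (s k) ▷ _ ≫ uncurry (T.map k l))
      simpa only [Category.assoc] using h3)
    refine ⟨curry (natLift _ hs'), fun k => uncurry_injective ((key _ k).trans ?_)⟩
    have h1 : ψ.obj k ◁ natLift _ hs' ≫ e k = s' k := by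
      refine (uncurry_natural_left _ _).symm.trans ?_
      rw [natLift_eval, uncurry_curry]
    refine Eq.trans ?_ (uncurry_natural_left _ _).symm
    rw [uncurry_curry, h1]
    dsimp only [s']
    rw [← braiding_swapLeft]
    simp only [Category.assoc]
  · intro a X f g h
    apply uncurry_injective
    refine nat_hom_ext fun k => uncurry_injective ?_
    have h1 := (key f k).symm.trans ((congrArg uncurry (h k)).trans (key g k))
    rw [cancel_epi, cancel_epi] at h1
    exact (uncurry_natural_left _ _).trans (h1.trans (uncurry_natural_left _ _).symm)

end Self

/-! ### Independence of the universe of objects. -/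

section Universes
variable {V : Type u} [Category.{w} V] [MonoidalCategory V]
variable {M : Type w} [EnrichedCategory V M] {A : Type u₁} [EnrichedCategory V A]
  {B : Type u₂} [EnrichedCategory V B]

/-- The copy of the `V`-category `A` in a larger universe. -/
instance uLiftEnriched : EnrichedCategory V (ULift.{v} A) where
  Hom a b := EnrichedCategory.Hom a.down b.down
  id a := eId V a.down
  comp a b c := eComp V a.down b.down c.down
  id_comp a b := e_id_comp V a.down b.down
  comp_id a b := e_comp_id V a.down b.down
  assoc a b c d := e_assoc V a.down b.down c.down d.down

/-- A `V`-functor between copies in larger universes. -/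
def uLiftFunctor (F : EnrichedFunctor V A B) :
    EnrichedFunctor V (ULift.{v₁} A) (ULift.{v₂} B) where
  obj a := ⟨F.obj a.down⟩
  map a b := F.map a.down b.down
  map_id a := F.map_id a.down
  map_comp a b c := F.map_comp a.down b.down c.down

/-- A diagram in a copy of `A`, as a diagram in `A`. -/
def downDiagram (T : EnrichedFunctor V M (ULift.{v} A)) : EnrichedFunctor V M A where
  obj m := (T.obj m).down
  map m n := T.map m n
  map_id m := T.map_id m
  map_comp k l m := T.map_comp k l m

/-- A diagram in `A`, as a diagram in a copy of `A`. -/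
def upDiagram (T : EnrichedFunctor V M A) : EnrichedFunctor V M (ULift.{v} A) where
  obj m := ⟨T.obj m⟩
  map m n := T.map m n
  map_id m := T.map_id m
  map_comp k l m := T.map_comp k l m

variable [SymmetricCategory V] [MonoidalClosed V] [HasLimits V]

/-- `ULift` leaves hom-objects and composition untouched, so cones and their comparison morphisms
carry over by definition. -/
lemma hasWeightedLimits_uLift {ψ : Weight V} (h : HasWeightedLimits ψ A) :
    HasWeightedLimits ψ (ULift.{v} A) := fun T => by
  obtain ⟨c, hc⟩ := h (downDiagram T)
  exact ⟨⟨⟨c.pt⟩, c.π, c.naturality⟩, fun a => hc a.down⟩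

lemma preservesWeightedLimits_uLift {ψ : Weight V} {F : EnrichedFunctor V A B}
    (h : PreservesWeightedLimits ψ F) :
    PreservesWeightedLimits ψ (uLiftFunctor.{w, u, u₁, u₂, v₁, v₂} F) := fun T c hc a =>
  h (downDiagram T) ⟨c.pt.down, c.π, c.naturality⟩ (fun a => hc ⟨a⟩) a.down

lemma preservesWeightedLimits_of_uLift {ψ : Weight V} {F : EnrichedFunctor V A B}
    (h : PreservesWeightedLimits ψ (uLiftFunctor.{w, u, u₁, u₂, v₁, v₂} F)) :
    PreservesWeightedLimits ψ F := fun T c hc a =>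
  h (upDiagram T) ⟨⟨c.pt⟩, c.π, c.naturality⟩ (fun a => hc a.down) ⟨a⟩

end Universes

/-! ### Using membership in a saturation. -/

section Saturation
variable {V : Type u} [Category.{w} V] [MonoidalCategory V] [SymmetricCategory V] [MonoidalClosed V]
  [HasLimits V]

lemma subset_saturation (Φ : Set (Weight V)) : Φ ⊆ saturation.{w, v, u} Φ :=
  fun _ h => ⟨fun _ _ hA => hA _ h, fun _ _ _ _ _ _ _ hF => hF _ h⟩

/-- Only the clause of the saturation about functors is needed. The clause speaks of one fixed
universe, so `F` is first lifted to it and the conclusion is brought back down. -/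
lemma preservesWeightedLimits_of_mem_saturation {Φ : Set (Weight V)} {ψ : Weight V}
    (hψ : ψ ∈ saturation.{w, v, u} Φ) {A : Type (max u w)} [EnrichedCategory V A]
    {B : Type u} [EnrichedCategory V B] (F : EnrichedFunctor V A B)
    (hA : ∀ φ : Weight V, HasWeightedLimits φ A) (hB : ∀ φ : Weight V, HasWeightedLimits φ B)
    (hF : IsContinuous Φ F) : PreservesWeightedLimits ψ F :=
  preservesWeightedLimits_of_uLift (hψ.2 (ULift.{max u w v} A) (ULift.{max u w v} B)
    (uLiftFunctor F) (fun φ _ => hasWeightedLimits_uLift (hA φ))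
    (fun φ _ => hasWeightedLimits_uLift (hB φ))
    (fun φ h => preservesWeightedLimits_uLift (hF φ h)))

end Saturation

/-! ### The unit of a weighted colimit. -/

section Colim
variable {V : Type u} [Category.{w} V] [MonoidalCategory V] [SymmetricCategory V] [MonoidalClosed V]
  [HasLimits V]
variable {K : Type w} [EnrichedCategory V K] {A : Type u₁} [EnrichedCategory V A]
variable (φ : EnrichedFunctor V K V)
  (hA : ∀ S : EnrichedFunctor V Kᵒᵖ A, ∃ c : WeightedCone φ (opDiagram S), c.IsLimit)

/-- The unit `φ k ⟶ A(S k, φ * S)` of the colimit. -/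
def colimι (S : EnrichedFunctor V Kᵒᵖ A) (k : K) :
    φ.obj k ⟶ (EnrichedCategory.Hom (S.obj (op k)) ((colimFunctor φ hA).obj S) : V) :=
  (colimCone φ hA S).π k

/-- Naturality in `S` of the unit, which characterizes the action of `φ * -` on hom-objects. It is
the factorization property of the lift in `Aᵒᵖ` that defines this action, with the braidings of the
opposite removed. -/
lemma colimι_map (S T : EnrichedFunctor V Kᵒᵖ A) (k : K) :
    (colimι φ hA S k ⊗ₘ (colimFunctor φ hA).map S T) ≫ eComp V _ _ _ =
      (β_ _ _).hom ≫ (natEval S T (op k) ⊗ₘ colimι φ hA T k) ≫ eComp V _ _ _ := by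
  have h := WeightedCone.IsLimit.map_fac (colimCone φ hA T) (colimCone_isLimit φ hA S) k
  have h1 := congrArg (fun z => opNat S T ▷ φ.obj k ≫ z) h
  rw [whiskerRight_comp_tensorHom_assoc, braiding_naturality_left_assoc,
    whiskerLeft_comp_tensorHom_assoc, opNat_eval] at h1
  have e1 := tensorHom_eComp_op_eq (V := V) (z := (colimCone φ hA T).pt)
    (y := (colimCone φ hA S).pt) (x := op (S.obj (op k)))
    ((colimFunctor φ hA).map S T) (colimι φ hA S k)
  have e2 := tensorHom_eComp_op_eq (V := V) (z := (colimCone φ hA T).pt)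
    (y := op (T.obj (op k))) (x := op (S.obj (op k))) (colimι φ hA T k) (natEval S T (op k))
  rw [← cancel_epi (β_ _ _).hom]
  exact e1.symm.trans (h1.trans (congrArg (fun z => _ ≫ z) e2))

lemma colimι_comp_map {S T : EnrichedFunctor V Kᵒᵖ A} {X : V} (f : X ⟶ natObj S T) (k : K) :
    (colimι φ hA S k ⊗ₘ (f ≫ (colimFunctor φ hA).map S T)) ≫ eComp V _ _ _ =
      (β_ _ _).hom ≫ ((f ≫ natEval S T (op k)) ⊗ₘ colimι φ hA T k) ≫ eComp V _ _ _ := by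
  refine (whiskerLeft_comp_tensorHom_assoc _ _ _ _).symm.trans
    ((congrArg (fun z => φ.obj k ◁ f ≫ z) (colimι_map φ hA S T k)).trans ?_)
  refine (braiding_naturality_right_assoc _ _ _).trans ?_
  exact congrArg (fun z => (β_ _ _).hom ≫ z) (whiskerRight_comp_tensorHom_assoc _ _ _ _)

end Colim

/-! ### Two-variable diagrams and the symmetry of commutation. -/

section Bifunctor
variable (V : Type u) [Category.{w} V] [MonoidalCategory V] [SymmetricCategory V]
variable (M : Type w) [EnrichedCategory V M] (K : Type w) [EnrichedCategory V K]
  (A : Type u₁) [EnrichedCategory V A]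

/-- A `V`-functor `M ⊗ K^op ⟶ A`, given by its partial functors. -/
structure Bifunctor where
  /-- the action on objects -/
  obj : M → K → A
  /-- functoriality in the first variable -/
  map₁ (m n : M) (k : K) : EnrichedCategory.Hom m n ⟶ (EnrichedCategory.Hom (obj m k) (obj n k) : V)
  /-- functoriality in the second variable -/
  map₂ (m : M) (k l : K) : EnrichedCategory.Hom k l ⟶ (EnrichedCategory.Hom (obj m l) (obj m k) : V)
  map₁_id (m : M) (k : K) : eId V m ≫ map₁ m m k = eId V (obj m k)
  map₂_id (m : M) (k : K) : eId V k ≫ map₂ m k k = eId V (obj m k)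
  map₁_comp (m n p : M) (k : K) : eComp V m n p ≫ map₁ m p k =
    (map₁ m n k ⊗ₘ map₁ n p k) ≫ eComp V (obj m k) (obj n k) (obj p k)
  map₂_comp (m : M) (k l j : K) : eComp V k l j ≫ map₂ m k j =
    (β_ _ _).hom ≫ (map₂ m l j ⊗ₘ map₂ m k l) ≫ eComp V (obj m j) (obj m l) (obj m k)
  comm (m n : M) (k l : K) :
    (map₂ m k l ⊗ₘ map₁ m n k) ≫ eComp V (obj m l) (obj m k) (obj n k) =
      (β_ _ _).hom ≫ (map₁ m n l ⊗ₘ map₂ n k l) ≫ eComp V (obj m l) (obj n l) (obj n k)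

namespace Bifunctor
variable {V M K A}

/-- The opposite `V`-functor `K ⊗ M^op ⟶ A^op`. -/
@[reducible]
def op (B : Bifunctor V M K A) : Bifunctor V K M Aᵒᵖ where
  obj k m := Opposite.op (B.obj m k)
  map₁ k l m := B.map₂ m k l
  map₂ k m n := B.map₁ m n k
  map₁_id k m := B.map₂_id m k
  map₂_id k m := B.map₁_id m k
  map₁_comp k l j m := (B.map₂_comp m k l j).trans (tensorHom_eComp_op_eq (V := V)
    (z := Opposite.op (B.obj m k)) (y := Opposite.op (B.obj m l)) (x := Opposite.op (B.obj m j))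
    (B.map₂ m k l) (B.map₂ m l j)).symm
  map₂_comp k m n p := by
    refine (B.map₁_comp m n p k).trans ?_
    have e := tensorHom_eComp_op_eq (V := V)
      (z := Opposite.op (B.obj p k)) (y := Opposite.op (B.obj n k)) (x := Opposite.op (B.obj m k))
      (B.map₁ n p k) (B.map₁ m n k)
    exact (SymmetricCategory.symmetry_assoc _ _ _).symm.trans (congrArg (fun z => _ ≫ z) e.symm)
  comm k l m n := by
    have e1 := tensorHom_eComp_op_eq (V := V) (z := Opposite.op (B.obj n k))
      (y := Opposite.op (B.obj m k)) (x := Opposite.op (B.obj m l)) (B.map₁ m n k) (B.map₂ m k l)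
    have e2 := tensorHom_eComp_op_eq (V := V) (z := Opposite.op (B.obj n k))
      (y := Opposite.op (B.obj n l)) (x := Opposite.op (B.obj m l)) (B.map₂ n k l) (B.map₁ m n l)
    refine e1.trans ((congrArg (fun z => _ ≫ z) (B.comm m n k l)).trans ?_)
    exact (congrArg (fun z => (β_ _ _).hom ≫ z) e2).symm

/-- The bifunctor with a given opposite. -/
@[reducible]
def unop (B : Bifunctor V K M Aᵒᵖ) : Bifunctor V M K A where
  obj m k := (B.obj k m).unop
  map₁ m n k := B.map₂ k m n
  map₂ m k l := B.map₁ k l m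
  map₁_id m k := B.map₂_id k m
  map₂_id m k := B.map₁_id k m
  map₁_comp m n p k := by
    refine (B.map₂_comp k m n p).trans ?_
    have e := tensorHom_eComp_op_eq (V := V) (B.map₂ k n p) (B.map₂ k m n)
    exact (congrArg (fun z => _ ≫ z) e).trans (SymmetricCategory.symmetry_assoc _ _ _)
  map₂_comp m k l j :=
    (B.map₁_comp k l j m).trans (tensorHom_eComp_op_eq (V := V) (B.map₁ k l m) (B.map₁ l j m))
  comm m n k l := by
    have e1 := tensorHom_eComp_op_eq (V := V) (B.map₂ k m n) (B.map₁ k l m)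
    have e2 := tensorHom_eComp_op_eq (V := V) (B.map₁ k l n) (B.map₂ l m n)
    exact (cancel_epi (β_ _ _).hom).1
      (e1.symm.trans ((B.comm k l m n).trans (congrArg (fun z => (β_ _ _).hom ≫ z) e2)))

/-- The partial functor `B(-, k) : M ⟶ A`. -/
@[reducible]
def row (B : Bifunctor V M K A) (k : K) : EnrichedFunctor V M A where
  obj m := B.obj m k
  map m n := B.map₁ m n k
  map_id m := B.map₁_id m k
  map_comp m n p := B.map₁_comp m n p k

/-- The partial functor `B(m, -) : K^op ⟶ A`. -/
@[reducible]
def col (B : Bifunctor V M K A) (m : M) : EnrichedFunctor V Kᵒᵖ A where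
  obj k := B.obj m k.unop
  map k l := B.map₂ m l.unop k.unop
  map_id k := B.map₂_id m k.unop
  map_comp k l j := by
    refine (Category.assoc _ _ _).trans
      ((congrArg (fun z => _ ≫ z) (B.map₂_comp m j.unop l.unop k.unop)).trans ?_)
    exact SymmetricCategory.symmetry_assoc _ _ _

variable [MonoidalClosed V] [HasLimits V]

lemma isNatural_map₁ (B : Bifunctor V M K A) (m n : M) :
    IsNatural (B.col m) (B.col n) (fun k => B.map₁ m n k.unop) :=
  fun k l => B.comm m n l.unop k.unop

/-- The `V`-functor `M ⟶ [K^op, A]` corresponding to a `V`-functor `M ⊗ K^op ⟶ A`. -/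
@[reducible]
def left (B : Bifunctor V M K A) : EnrichedFunctor V M (EnrichedFunctor V Kᵒᵖ A) where
  obj m := B.col m
  map m n := natLift _ (B.isNatural_map₁ m n)
  map_id m := nat_hom_ext fun k => by
    rw [Category.assoc, natLift_eval]
    exact (B.map₁_id m k.unop).trans (natId_eval (B.col m) k).symm
  map_comp m n p := nat_hom_ext fun k => by
    rw [Category.assoc, natLift_eval, tensor_natEval, natLift_eval, natLift_eval]
    exact B.map₁_comp m n p k.unop

lemma left_map_eval (B : Bifunctor V M K A) (m n : M) (k : Kᵒᵖ) :
    B.left.map m n ≫ natEval (B.col m) (B.col n) k = B.map₁ m n k.unop :=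
  natLift_eval _ (B.isNatural_map₁ m n) k

/-- Lets an arbitrary diagram in `[K^op, A]` be replaced by a two-variable functor, which then has a
transposed diagram `B.op.left`. -/
lemma exists_left_eq (T : EnrichedFunctor V M (EnrichedFunctor V Kᵒᵖ A)) :
    ∃ B : Bifunctor V M K A, B.left = T := by
  refine ⟨⟨fun m k => (T.obj m).obj (Opposite.op k),
    fun m n k => T.map m n ≫ natEval (T.obj m) (T.obj n) (Opposite.op k),
    fun m k l => (T.obj m).map (Opposite.op l) (Opposite.op k), ?_, ?_, ?_, ?_, ?_⟩, ?_⟩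
  · intro m k
    rw [T.map_id_assoc]
    exact natId_eval _ _
  · intro m k
    exact (T.obj m).map_id (Opposite.op k)
  · intro m n p k
    rw [T.map_comp_assoc, ← Category.assoc, tensor_natEval]
  · intro m k l j
    have h := (T.obj m).map_comp (Opposite.op j) (Opposite.op l) (Opposite.op k)
    rw [← h, eComp_op_eq, Category.assoc, SymmetricCategory.symmetry_assoc]
  · intro m n k l
    exact natEval_natural (T.map m n) (Opposite.op l) (Opposite.op k)
  · refine EnrichedFunctor.ext V (fun m => rfl) fun m n => ?_
    refine (Category.comp_id _).trans (nat_hom_ext fun k => ?_)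
    exact left_map_eval _ m n k

lemma exists_op_left_eq (T : EnrichedFunctor V K (EnrichedFunctor V Mᵒᵖ Aᵒᵖ)) :
    ∃ B : Bifunctor V M K A, B.op.left = T := by
  obtain ⟨B, hB⟩ := exists_left_eq (M := K) (K := M) (A := Aᵒᵖ) T
  -- `B.unop.op` is `B` by definition.
  exact ⟨B.unop, hB⟩

variable (B : Bifunctor V M K A) {φ : EnrichedFunctor V K V} {ψ : EnrichedFunctor V M V}
  (hφ : ∀ S : EnrichedFunctor V Kᵒᵖ A, ∃ c : WeightedCone φ (opDiagram S), c.IsLimit)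
  (hψ : ∀ S : EnrichedFunctor V Mᵒᵖ Aᵒᵖ, ∃ c : WeightedCone ψ (opDiagram S), c.IsLimit)

/-- The `V`-functor `m ↦ φ * B(m, -)`. -/
abbrev colimLeft : EnrichedFunctor V M A := B.left.comp V (colimFunctor φ hφ)

/-- The `V`-functor `k ↦ {ψ, B(-, k)}`, as a functor `K ⟶ A^op`. -/
abbrev limRight : EnrichedFunctor V K Aᵒᵖ := B.op.left.comp V (colimFunctor ψ hψ)

/-- The unit `φ k ⟶ A(B(m, k), φ * B(m, -))`. -/
def ι (m : M) (k : K) : φ.obj k ⟶ (EnrichedCategory.Hom (B.obj m k) ((B.colimLeft hφ).obj m) : V) :=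
  colimι φ hφ (B.col m) k

/-- The counit `ψ m ⟶ A({ψ, B(-, k)}, B(m, k))`. -/
def π (m : M) (k : K) :
    ψ.obj m ⟶ (EnrichedCategory.Hom ((B.limRight hψ).obj k).unop (B.obj m k) : V) :=
  colimι ψ hψ (B.op.col k) m

lemma ι_map (m n : M) (k : K) :
    (B.ι hφ m k ⊗ₘ (B.colimLeft hφ).map m n) ≫ eComp V _ _ _ =
      (β_ _ _).hom ≫ (B.map₁ m n k ⊗ₘ B.ι hφ n k) ≫ eComp V _ _ _ := by
  refine (colimι_comp_map φ hφ (B.left.map m n) k).trans ?_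
  rw [left_map_eval]
  rfl

/-- Dual to `ι_map`: the same statement for `B.op`, rewritten from `Aᵒᵖ` to `A`. -/
lemma map_π (m : M) (k l : K) :
    (((B.limRight hψ).map k l : EnrichedCategory.Hom k l ⟶ EnrichedCategory.Hom
        ((B.limRight hψ).obj l).unop ((B.limRight hψ).obj k).unop) ⊗ₘ B.π hψ m k) ≫
          eComp V ((B.limRight hψ).obj l).unop ((B.limRight hψ).obj k).unop (B.obj m k) =
      (β_ _ _).hom ≫ (B.π hψ m l ⊗ₘ B.map₂ m k l) ≫
        eComp V ((B.limRight hψ).obj l).unop (B.obj m l) (B.obj m k) := by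
  have h := B.op.ι_map hψ k l m
  have e1 := tensorHom_eComp_op_eq (V := V) (B.op.ι hψ k m) ((B.limRight hψ).map k l)
  have e2 := tensorHom_eComp_op_eq (V := V) (B.op.map₁ k l m) (B.op.ι hψ l m)
  exact (cancel_epi (β_ _ _).hom).1
    (e1.symm.trans (h.trans (congrArg (fun z => (β_ _ _).hom ≫ z) e2)))

/-- The limit cone `ψ m ⟶ A({ψ, B(-, k)}, B(m, k))`. -/
def rowCone (k : K) : WeightedCone ψ (B.row k) where
  pt := ((B.limRight hψ).obj k).unop
  π m := B.π hψ m k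
  naturality m n := (doubleOp_naturality_iff (R := B.row k) (p := fun m => B.π hψ m k)).2
    ((colimCone ψ hψ (B.op.col k)).naturality m n)

lemma rowCone_isLimit (k : K) : (B.rowCone hψ k).IsLimit :=
  isLimit_doubleOp_iff.2 (colimCone_isLimit ψ hψ (B.op.col k))

lemma isNatural_π (m : M) : IsNatural (unopDiagram (B.limRight hψ)) (B.col m)
    (fun k => B.π hψ m k.unop) :=
  fun k l => B.map_π hψ m l.unop k.unop

lemma isNatural_ι (k : K) : IsNatural (opFunctor (B.colimLeft hφ)) (B.op.col k)
    (fun m => B.ι hφ m.unop k) := by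
  intro m n
  have h := B.ι_map hφ n.unop m.unop k
  have e1 := tensorHom_eComp_op_eq (V := V) (z := Opposite.op ((B.colimLeft hφ).obj m.unop))
    (y := Opposite.op ((B.colimLeft hφ).obj n.unop)) (x := Opposite.op (B.obj n.unop k))
    ((B.colimLeft hφ).map n.unop m.unop) (B.ι hφ n.unop k)
  have e2 := tensorHom_eComp_op_eq (V := V) (z := Opposite.op ((B.colimLeft hφ).obj m.unop))
    (y := Opposite.op (B.obj m.unop k)) (x := Opposite.op (B.obj n.unop k))
    (B.ι hφ m.unop k) (B.map₁ n.unop m.unop k)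
  exact e1.trans ((congrArg (fun z => (β_ _ _).hom ≫ z) h).trans
    (congrArg (fun z => (β_ _ _).hom ≫ z) e2.symm))

/-- The pointwise limit of `B`, regarded as a functor `M ⟶ [K^op, A]`. -/
def limCone : WeightedCone ψ B.left where
  pt := unopDiagram (B.limRight hψ)
  π m := natLift _ (B.isNatural_π hψ m)
  naturality m n := nat_hom_ext fun k => by
    rw [tensor_natEval, Category.assoc, natLift_eval, natLift_eval, left_map_eval]
    exact (B.rowCone hψ k.unop).naturality m n

/-- The pointwise colimit of `B`, regarded as a functor `K ⟶ [M^op, A^op]`. -/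
def colimCocone : WeightedCone φ B.op.left where
  pt := opFunctor (B.colimLeft hφ)
  π k := natLift _ (B.isNatural_ι hφ k)
  naturality k l := nat_hom_ext fun m => by
    rw [tensor_natEval, Category.assoc, natLift_eval, natLift_eval, left_map_eval]
    exact (colimCone φ hφ (B.col m.unop)).naturality k l

lemma limCone_π_eval (m : M) (k : Kᵒᵖ) :
    (B.limCone hψ).π m ≫ natEval (unopDiagram (B.limRight hψ)) (B.col m) k = B.π hψ m k.unop :=
  natLift_eval _ (B.isNatural_π hψ m) k

lemma colimCocone_π_eval (k : K) (m : Mᵒᵖ) :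
    (B.colimCocone hφ).π k ≫ natEval (opFunctor (B.colimLeft hφ)) (B.op.col k) m =
      B.ι hφ m.unop k :=
  natLift_eval _ (B.isNatural_ι hφ k) m

/-- Evaluation at `k` returns the limit cone `rowCone` of the partial functor `B(-, k)`, so
pointwise recognition of limits applies. -/
lemma limCone_isLimit : (B.limCone hψ).IsLimit :=
  isLimit_of_eval fun k => (B.rowCone_isLimit hψ k.unop).congr
    (EnrichedFunctor.ext V (fun _ => rfl) fun m n =>
      (Category.comp_id _).trans (B.left_map_eval m n k).symm) rfl
    (heq_of_eq (funext fun m => (B.limCone_π_eval hψ m k).symm))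

lemma colimCocone_isLimit : (B.colimCocone hφ).IsLimit :=
  isLimit_of_eval fun m => (colimCone_isLimit φ hφ (B.col m.unop)).congr
    (EnrichedFunctor.ext V (fun _ => rfl) fun k l =>
      (Category.comp_id _).trans (B.op.left_map_eval k l m).symm) rfl
    (heq_of_eq (funext fun k => (B.colimCocone_π_eval hφ k m).symm))

/-- Both conditions say that the canonical morphism `φ * {ψ, B} ⟶ {ψ, φ * B}` is invertible. -/
lemma isLimit_map_iff : ((B.limCone hψ).map (colimFunctor φ hφ)).IsLimit ↔
    ((B.colimCocone hφ).map (colimFunctor ψ hψ)).IsLimit := by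
  -- `q` is the limit `{ψ, φ * B}`, brought back from `(A^op)^op`, and `j` below is the colimit `φ *
  -- {ψ, B}`.
  let q : WeightedCone ψ (B.colimLeft hφ) :=
    { pt := (colimCone ψ hψ (opFunctor (B.colimLeft hφ))).pt.unop.unop
      π := fun m => colimι ψ hψ (opFunctor (B.colimLeft hφ)) m
      naturality := fun m n => (doubleOp_naturality_iff (R := B.colimLeft hφ)
        (p := fun m => colimι ψ hψ (opFunctor (B.colimLeft hφ)) m)).2
        ((colimCone ψ hψ (opFunctor (B.colimLeft hφ))).naturality m n) }
  have hq : q.IsLimit :=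
    isLimit_doubleOp_iff.2 (colimCone_isLimit ψ hψ (opFunctor (B.colimLeft hφ)))
  let j : WeightedCone φ (B.limRight hψ) := colimCone φ hφ (unopDiagram (B.limRight hψ))
  have hj : j.IsLimit := colimCone_isLimit φ hφ (unopDiagram (B.limRight hψ))
  refine isLimit_iff_isLimit_of_compatible hq hj _ _ _ _ fun k m => ?_
  -- Both induced families `φ k ⊗ ψ m ⟶ A({ψ, B(-, k)}, φ * B(m, -))` equal the counit followed by
  -- the unit through `B(m, k)`: `e1` and `e3` show it for one, `e2` and `e4` for the other, and
  -- `e5` and `e6` translate from `Aᵒᵖ`.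
  have e1 := colimι_comp_map φ hφ ((B.limCone hψ).π m) k
  have e2 := colimι_comp_map ψ hψ ((B.colimCocone hφ).π k) m
  have e3 := congrArg (fun z => (β_ _ _).hom ≫ (z ⊗ₘ colimι φ hφ (B.col m) k) ≫ eComp V _ _ _)
    (B.limCone_π_eval hψ m (Opposite.op k))
  have e4 := congrArg (fun z => (β_ _ _).hom ≫ (z ⊗ₘ colimι ψ hψ (B.op.col k) m) ≫ eComp V _ _ _)
    (B.colimCocone_π_eval hφ k (Opposite.op m))
  have e5 := tensorHom_eComp_op_eq (V := V) (z := Opposite.op ((B.colimLeft hφ).obj m))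
    (y := Opposite.op q.pt) (x := (B.limRight hψ).obj k) (q.π m)
    ((B.colimCocone hφ).π k ≫ (colimFunctor ψ hψ).map (B.colimCocone hφ).pt (B.op.left.obj k))
  have e6 := congrArg (fun z => (β_ _ _).hom ≫ z) (tensorHom_eComp_op_eq (V := V)
    (z := Opposite.op ((B.colimLeft hφ).obj m)) (y := Opposite.op (B.obj m k))
    (x := (B.limRight hψ).obj k) (B.ι hφ m k) (B.π hψ m k))
  exact (e1.trans e3).trans ((cancel_epi (β_ _ _).hom).1
    (e5.symm.trans ((e2.trans e4).trans e6))).symm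

/-- The functor `φ * -` on `[K^op, A]` preserves `ψ`-limits if and only if the functor `{ψ, -}` on
`[M, A]` preserves `φ`-colimits, where `{ψ, -}` is written as a functor on `[M^op, A^op]`. -/
lemma _root_.EnrichedWeights.preservesWeightedLimits_colimFunctor_iff {φ ψ : Weight V}
    (hφ : ∀ S : EnrichedFunctor V φ.domᵒᵖ A,
      ∃ c : WeightedCone φ.functor (opDiagram S), c.IsLimit)
    (hψ : ∀ S : EnrichedFunctor V ψ.domᵒᵖ Aᵒᵖ,
      ∃ c : WeightedCone ψ.functor (opDiagram S), c.IsLimit) :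
    PreservesWeightedLimits ψ (colimFunctor φ.functor hφ) ↔
      PreservesWeightedLimits φ (colimFunctor ψ.functor hψ) := by
  constructor
  · intro h T c hc
    -- Preservation need only be checked on one limit cone over the diagram; the pointwise one is
    -- used.
    obtain ⟨B, rfl⟩ := exists_op_left_eq T
    exact (B.colimCocone_isLimit hφ).map_of_map hc
      ((B.isLimit_map_iff hφ hψ).1 (h _ _ (B.limCone_isLimit hψ)))
  · intro h T c hc
    obtain ⟨B, rfl⟩ := exists_left_eq T
    exact (B.limCone_isLimit hψ).map_of_map hc
      ((B.isLimit_map_iff hφ hψ).2 (h _ _ (B.colimCocone_isLimit hφ)))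

end Bifunctor
end Bifunctor

/-! ### Commutation in `V` passes to saturations. -/

section Flatness
variable {V : Type u} [Category.{w} V] [MonoidalCategory V] [SymmetricCategory V] [MonoidalClosed V]
  [HasLimits V]

lemma hasWeightedLimits_self (ψ : Weight V) : HasWeightedLimits ψ V :=
  exists_limit_self ψ.functor

/-- The functor `{ψ, -}` that takes the `ψ`-limit of a diagram in `V`, as a functor
`[K^op, V^op] ⟶ V^op`. -/
def weightedLim (ψ : Weight V) : EnrichedFunctor V (EnrichedFunctor V ψ.domᵒᵖ Vᵒᵖ) Vᵒᵖ :=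
  colimFunctor ψ.functor (exists_limit_opDiagram (hasWeightedLimits_self ψ))

variable [HasColimits V]

lemma hasWeightedLimits_op (φ : Weight V) : HasWeightedLimits φ Vᵒᵖ :=
  fun T => exists_colimit φ.functor (unopDiagram T)

/-- Makes `φ` the weight of the limits being preserved, as is needed to use that `φ` lies in a
saturation. -/
lemma colimitsCommuteLimits_iff (φ ψ : Weight V) :
    ColimitsCommuteLimits φ ψ ↔ PreservesWeightedLimits φ (weightedLim ψ) :=
  preservesWeightedLimits_colimFunctor_iff _ _

/-- If limits with weight `ψ` commute in `V` with colimits with weights in `Φ`, then they commute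
with colimits with weights in the saturation of `Φ`. -/
lemma colimitsCommuteLimits_of_mem_saturation_left {Φ : Set (Weight V)} {φ ψ : Weight V}
    (hφ : φ ∈ saturation.{w, v, u} Φ) (h : ∀ φ' ∈ Φ, ColimitsCommuteLimits φ' ψ) :
    ColimitsCommuteLimits φ ψ :=
  (colimitsCommuteLimits_iff φ ψ).2 <| preservesWeightedLimits_of_mem_saturation hφ _
    (fun φ' => hasWeightedLimits_functorCategory (hasWeightedLimits_op φ')) hasWeightedLimits_op
    fun φ' hφ' => (colimitsCommuteLimits_iff φ' ψ).1 (h φ' hφ')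

/-- If colimits with weight `φ` commute in `V` with limits with weights in `Ψ`, then they commute
with limits with weights in the saturation of `Ψ`. -/
lemma colimitsCommuteLimits_of_mem_saturation_right {Ψ : Set (Weight V)} {φ ψ : Weight V}
    (hψ : ψ ∈ saturation.{w, v, u} Ψ) (h : ∀ ψ' ∈ Ψ, ColimitsCommuteLimits φ ψ') :
    ColimitsCommuteLimits φ ψ :=
  preservesWeightedLimits_of_mem_saturation hψ _
    (fun ψ' => hasWeightedLimits_functorCategory (hasWeightedLimits_self ψ'))
    hasWeightedLimits_self h

end Flatness

end EnrichedWeights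
end

theorem proposition5p1 (V : Type u) [Category.{w} V] [MonoidalCategory V] [SymmetricCategory V]
    [MonoidalClosed V] [HasLimits V] [HasColimits V] (Φ Ψ : Set (EnrichedWeights.Weight V)) :
    EnrichedWeights.saturation.{w, v, u} (EnrichedWeights.plus Ψ) = EnrichedWeights.plus Ψ ∧
    EnrichedWeights.saturation.{w, v, u} (EnrichedWeights.minus Φ) = EnrichedWeights.minus Φ ∧
    EnrichedWeights.plus Ψ = EnrichedWeights.plus (EnrichedWeights.saturation.{w, v, u} Ψ) ∧
    EnrichedWeights.minus Φ = EnrichedWeights.minus (EnrichedWeights.saturation.{w, v, u} Φ) := by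
  refine ⟨Set.Subset.antisymm ?_ (EnrichedWeights.subset_saturation _),
    Set.Subset.antisymm ?_ (EnrichedWeights.subset_saturation _),
    Set.Subset.antisymm ?_ ?_, Set.Subset.antisymm ?_ ?_⟩
  -- With `ψ ∈ Ψ` fixed, every weight of `plus Ψ` commutes with `ψ`, hence so does every weight of
  -- its saturation. The case of `minus Φ` is dual.
  · exact fun φ hφ ψ hψ =>
      EnrichedWeights.colimitsCommuteLimits_of_mem_saturation_left hφ fun φ' h => h ψ hψ
  · exact fun ψ hψ φ hφ =>
      EnrichedWeights.colimitsCommuteLimits_of_mem_saturation_right hψ fun ψ' h => h φ hφ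
  · exact fun φ hφ ψ hψ => EnrichedWeights.colimitsCommuteLimits_of_mem_saturation_right hψ hφ
  · exact fun φ hφ ψ hψ => hφ ψ (EnrichedWeights.subset_saturation Ψ hψ)
  · exact fun ψ hψ φ hφ => EnrichedWeights.colimitsCommuteLimits_of_mem_saturation_left hφ hψ
  · exact fun ψ hψ φ hφ => hψ φ (EnrichedWeights.subset_saturation Φ hφ)
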